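/- **Setting.** Let $d\ge 1$ and let $\mathcal K\subset\mathbb R^d$ be compact and convex with non-empty interior. A convex $C^3$ function $\Phi:\operatorname{int}\mathcal K\to\mathbb R$ is *self-concordant with constant* $M_\Phi$ if $\Phi(x_k)\to+\infty$ whenever $x_k\to x\in\partial\mathcal K$, and $|\nabla^3\Phi(x)[u,u,u]|\le 2M_\Phi\|u\|_{\nabla^2\Phi(x)}^3$ for all $x\in\operatorname{int}\mathcal K$, $u\in\mathbb R^d$, where $\|u\|_A=\sqrt{u^\top A u}$. Write $\nabla^{-2}\Phi=(\nabla^2\Phi)^{-1}$. A gradient oracle with tolerance $\varepsilon$ returns at $w\in\operatorname{int}\mathcal K$ a vector $\widehat\nabla_w$ with $\|\widehat\nabla_w-\nabla\Phi(w)\|_{\nabla^{-2}\Phi(w)}\le\varepsilon$, at cost $\mathcal C^{\rm grad}_\varepsilon$ per call. A Hessian oracle with tolerance $\alpha$ returns at $w\in\operatorname{int}\mathcal K$ a matrix $H$ and its inverse with $(1-\alpha)\nabla^2\Phi(w)\preceq H\preceq(1+\alpha)\nabla^2\Phi(w)$ and $(1-\alpha)\nabla^{-2}\Phi(w)\preceq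 H^{-1}\preceq(1+\alpha)\nabla^{-2}\Phi(w)$, at cost $\mathcal C^{\rm hess}_\alpha$ per call. Every elementary operation on real numbers (arithmetic operation, square root, comparison) costs $1$. **Algorithm (BARONS)** with parameters $\eta,\varepsilon,\alpha,m$. Let $w^\star$ be the minimizer of $\Phi$; set $u_1=w_1=w^\star$, let $(H_1,H_1^{-1})$ be the answer of the Hessian oracle at $w^\star$, and $s_0=0$. In round $t=1,\dots,T$: play $w_t$ and observe $g_t\in\partial\ell_t(w_t)$, where $\ell_t:\mathcal K\to\mathbb R$ is convex and may depend on the past and on $w_t$; set $s_t=s_{t-1}+\eta g_t$ and $w_{t+1}^1=w_t$; for $j=1,\dots,m-1$ query the gradient oracle at $w_{t+1}^j$, obtaining $\widehat\nabla_{t+1}^j$, and set $w_{t+1}^{j+1}=w_{t+1}^j-H_t^{-1}(\widehat\nabla_{t+1}^j+s_t)$; set $w_{t+1}=w_{t+1}^m$. If $\|w_{t+1}-u_t\|_{H_t}\le 1/(41M_\Phi)$, keep $u_{t+1}=u_t$, $H_{t+1}=H_t$; otherwise set $u_{t+1}=w_{t+1}$ and let $(H_{t+1},H_{t+1}^{-1})$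 be the answer of the Hessian oracle at $u_{t+1}$. **Theorem (Master theorem).** There are universal constants $c_1,C>0$ and, for every $c_2\ge c_1$, a constant $C'>0$ depending only on $c_2$, such that the following holds. Let $\Phi$ be self-concordant over $\mathcal K$ with constant $M_\Phi>0$, let $b,\eta,\varepsilon>0$ with $\eta\le\frac1{1000\,bM_\Phi}$ and $\varepsilon\le\frac1{20000M_\Phi}$, let $\alpha=0.001$, and let $m\in\mathbb N$ with $c_1\log\frac1{\varepsilon M_\Phi}\le m\le c_2\log\frac1{\varepsilon M_\Phi}$ (that is, $m=\Theta(\log\frac1{\varepsilon M_\Phi})$). Run BARONS for $T\ge 0$ rounds and suppose that $\|g_t\|_{\nabla^{-2}\Phi(w_t)}\le b$ for all $t\le T$. Then all points that are played or at which an oracle is called lie in $\operatorname{int}\mathcal K$, and for every $w\in\operatorname{int}\mathcal K$ $$\sum_{t=1}^T\big(\ell_t(w_t)-\ell_t(w)\big)\le C\Big(\frac{\Phi(w)-\Phi(w^\star)}\eta+\eta\sum_{t=1}^T\|g_t\|^2_{\nabla^{-2}\Phi(w_t)}+\varepsilon\sum_{t=1}^T\|g_t\|_{\nabla^{-2}\Phi(w_t)}\Big).$$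 After the initial Hessian computation at $w^\star$, the Hessian is recomputed at most $C\big(M_\Phi T\varepsilon+M_\Phi\sum_{t=1}^T\eta\|g_t\|_{\nabla^{-2}\Phi(w_t)}\big)$ times, and the total computational cost is at most $$\mathcal C^{\rm hess}_\alpha+C'\Big((\mathcal C^{\rm grad}_\varepsilon+d^2)\,T\log\frac1{\varepsilon M_\Phi}+\mathcal C^{\rm hess}_\alpha\Big(M_\Phi T\varepsilon+M_\Phi\sum_{t=1}^T\eta\|g_t\|_{\nabla^{-2}\Phi(w_t)}\Big)\Big).$$ -/

import Mathlib

open scoped MatrixOrder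

noncomputable section

namespace BARONS

/-- The Euclidean space `ℝ^d`. -/
abbrev E (d : ℕ) : Type := EuclideanSpace ℝ (Fin d)

/-- Real `d × d` matrices. -/
abbrev Mat (d : ℕ) : Type := Matrix (Fin d) (Fin d) ℝ

/-! ### Local norms, Hessians, self-concordance, subgradients -/

/-- The norm `‖v‖_A = √(vᵀ A v)` attached to a positive semidefinite matrix `A`. -/
def localNorm {d : ℕ} (A : Mat d) (v : E d) : ℝ :=
  Real.sqrt (v.ofLp ⬝ᵥ A.mulVec v.ofLp)

/-- The Hessian matrix `∇²f(x)`, with entries the second partial derivatives of `f` at `x`. -/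
def hessian {d : ℕ} (f : E d → ℝ) (x : E d) : Mat d :=
  Matrix.of fun i j =>
    iteratedFDeriv ℝ 2 f x ![EuclideanSpace.single i 1, EuclideanSpace.single j 1]

/-- The dual local norm `‖g‖_{∇⁻²f(x)} = √(gᵀ (∇²f(x))⁻¹ g)`. -/
def dualLocalNorm {d : ℕ} (f : E d → ℝ) (x g : E d) : ℝ :=
  localNorm (hessian f x)⁻¹ g

/-- `f : int K → ℝ` is a self-concordant function over `K` with constant `M`
(only the values of `f` on `int K` matter). -/
structure IsSelfConcordant {d : ℕ} (K : Set (E d)) (f : E d → ℝ) (M : ℝ) : Prop where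
  nonneg : 0 ≤ M
  convexOn : ConvexOn ℝ (interior K) f
  contDiffOn : ContDiffOn ℝ 3 f (interior K)
  tendsto_frontier : ∀ x ∈ frontier K,
    Filter.Tendsto f (nhdsWithin x (interior K)) Filter.atTop
  third_deriv_le : ∀ x ∈ interior K, ∀ u : E d,
    |iteratedFDeriv ℝ 3 f x (fun _ => u)| ≤ 2 * M * localNorm (hessian f x) u ^ 3

/-- `g ∈ ∂ℓ(w)`, for a function `ℓ : K → ℝ`. -/
def IsSubgradient {d : ℕ} (K : Set (E d)) (l : E d → ℝ) (w g : E d) : Prop :=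
  ∀ v ∈ K, l w + inner ℝ g (v - w) ≤ l v

/-! ### Oracles -/

/-- The answers of a gradient oracle and of a Hessian oracle. The latter returns a matrix together
with its inverse. -/
structure Oracles (d : ℕ) where
  grad : E d → E d
  hess : E d → Mat d × Mat d

/-- `O` is a gradient oracle for `Φ` over `int K` with tolerance `ε`. -/
def IsGradOracle {d : ℕ} (K : Set (E d)) (Φ : E d → ℝ) (ε : ℝ) (O : E d → E d) : Prop :=
  ∀ w ∈ interior K, dualLocalNorm Φ w (O w - gradient Φ w) ≤ ε

/-- `O` is a Hessian oracle for `Φ` over `int K` with tolerance `α`. Here `≤` is the Loewner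
order: `A ≤ B` means that `B - A` is positive semidefinite. -/
def IsHessOracle {d : ℕ} (K : Set (E d)) (Φ : E d → ℝ) (α : ℝ) (O : E d → Mat d × Mat d) : Prop :=
  ∀ w ∈ interior K,
    (O w).1 * (O w).2 = 1 ∧
    (1 - α) • hessian Φ w ≤ (O w).1 ∧ (O w).1 ≤ (1 + α) • hessian Φ w ∧
    (1 - α) • (hessian Φ w)⁻¹ ≤ (O w).2 ∧ (O w).2 ≤ (1 + α) • (hessian Φ w)⁻¹

/-! ### The cost model

Programs are written in a monad which records, besides the returned value, how many operations of
each kind were executed: elementary operations on real numbers (arithmetic, square root,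
comparison), calls to the gradient oracle, and calls to the Hessian oracle. -/

/-- The kinds of operations that are charged. -/
inductive Op where
  | arith
  | gradCall
  | hessCall
  deriving DecidableEq

/-- A value together with the number of operations of each kind used to compute it. -/
structure Timed (α : Type) where
  val : α
  count : Op → ℕ

namespace Timed

/-- Sequential composition adds up the operation counts. -/
instance : Monad Timed where
  pure a := ⟨a, 0⟩
  bind x f := ⟨(f x.val).val, x.count + (f x.val).count⟩

@[simp] theorem val_pure {α : Type} (a : α) : (pure a : Timed α).val = a := rfl

@[simp] theorem count_pure {α : Type} (a : α) : (pure a : Timed α).count = 0 := rfl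

@[simp] theorem val_bind {α β : Type} (x : Timed α) (f : α → Timed β) :
    (x >>= f).val = (f x.val).val := rfl

@[simp] theorem count_bind {α β : Type} (x : Timed α) (f : α → Timed β) :
    (x >>= f).count = x.count + (f x.val).count := rfl

/-- Execute one operation of kind `o` returning `a`. -/
def tick {α : Type} (o : Op) (a : α) : Timed α := ⟨a, Pi.single o 1⟩

/-- The total cost of a computation, when an elementary operation costs `1`, a gradient oracle
call costs `Cgrad` and a Hessian oracle call costs `Chess`. -/
def totalCost {α : Type} (Cgrad Chess : ℝ) (x : Timed α) : ℝ :=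
  x.count Op.arith + Cgrad * x.count Op.gradCall + Chess * x.count Op.hessCall

end Timed

open Timed

/-! Elementary operations on real numbers. -/

def add (x y : ℝ) : Timed ℝ := tick Op.arith (x + y)
def sub (x y : ℝ) : Timed ℝ := tick Op.arith (x - y)
def mul (x y : ℝ) : Timed ℝ := tick Op.arith (x * y)
def div (x y : ℝ) : Timed ℝ := tick Op.arith (x / y)
def sqrt (x : ℝ) : Timed ℝ := tick Op.arith (Real.sqrt x)
def leq (x y : ℝ) : Timed Bool := tick Op.arith (decide (x ≤ y))

/-! Loops over the coordinates, and the linear algebra built from them. -/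

/-- Compute a vector coordinate by coordinate. -/
def mkVec {d : ℕ} (f : Fin d → Timed ℝ) : Timed (E d) :=
  ⟨WithLp.toLp 2 fun i => (f i).val, ∑ i, (f i).count⟩

/-- Compute `d` numbers and add them up, starting from `0`, with `d` additions. -/
def sumLoop {d : ℕ} (f : Fin d → Timed ℝ) : Timed ℝ :=
  ⟨∑ i, (f i).val, ∑ i, ((f i).count + Pi.single Op.arith 1)⟩

def vecAdd {d : ℕ} (x y : E d) : Timed (E d) := mkVec fun i => add (x i) (y i)
def vecSub {d : ℕ} (x y : E d) : Timed (E d) := mkVec fun i => sub (x i) (y i)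
def vecScale {d : ℕ} (c : ℝ) (x : E d) : Timed (E d) := mkVec fun i => mul c (x i)
def dot {d : ℕ} (x y : E d) : Timed ℝ := sumLoop fun i => mul (x i) (y i)
def matVec {d : ℕ} (A : Mat d) (x : E d) : Timed (E d) :=
  mkVec fun i => sumLoop fun j => mul (A i j) (x j)

/-- Computes `‖x‖_A`. -/
def normLoop {d : ℕ} (A : Mat d) (x : E d) : Timed ℝ := do
  let y ← matVec A x
  let q ← dot x y
  sqrt q

def callGrad {d : ℕ} (O : Oracles d) (w : E d) : Timed (E d) := tick Op.gradCall (O.grad w)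
def callHess {d : ℕ} (O : Oracles d) (w : E d) : Timed (Mat d × Mat d) :=
  tick Op.hessCall (O.hess w)

/-! ### The algorithm BARONS -/

/-- The memory of the algorithm when a round begins. -/
structure State (d : ℕ) where
  /-- the iterate that is played in this round -/
  w : E d
  /-- the current landmark -/
  u : E d
  /-- `η` times the sum of the subgradients observed so far -/
  s : E d
  /-- the approximate Hessian at the landmark -/
  H : Mat d
  /-- its inverse -/
  Hinv : Mat d

/-- `k` approximate Newton steps starting from `y`, with the fixed inverse Hessian
approximation `Hinv` and the fixed linear term `s`. -/
def newtonLoop {d : ℕ} (O : Oracles d) (Hinv : Mat d) (s : E d) : ℕ → E d → Timed (E d)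
  | 0, y => pure y
  | k + 1, y => do
    let gradHat ← callGrad O y
    let gradTilde ← vecAdd gradHat s
    let h ← matVec Hinv gradTilde
    let y' ← vecSub y h
    newtonLoop O Hinv s k y'

/-- Line 1: start at the minimizer `wstar` of `Φ`, which is also the first landmark. -/
def start {d : ℕ} (O : Oracles d) (wstar : E d) : Timed (State d) := do
  let HH ← callHess O wstar
  pure { w := wstar, u := wstar, s := 0, H := HH.1, Hinv := HH.2 }

/-- One round: `S.w` has been played and `g` has been observed. The intermediate points are
`w¹ = S.w, …, w^{mNewton}`, hence there are `mNewton - 1` Newton steps. -/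
def playRound {d : ℕ} (O : Oracles d) (η M : ℝ) (mNewton : ℕ) (S : State d) (g : E d) :
    Timed (State d) := do
  let ηg ← vecScale η g
  let s ← vecAdd S.s ηg
  let w ← newtonLoop O S.Hinv s (mNewton - 1) S.w
  let v ← vecSub w S.u
  let r ← normLoop S.H v
  let c ← mul 41 M
  let threshold ← div 1 c
  let close ← leq r threshold
  if close then
    pure { w := w, u := S.u, s := s, H := S.H, Hinv := S.Hinv }
  else do
    let HH ← callHess O w
    pure { w := w, u := w, s := s, H := HH.1, Hinv := HH.2 }

/-- BARONS after `t` rounds in which the subgradients `g 0, …, g (t - 1)` were observed. Rounds are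
numbered from `0`, and the state after `t` rounds contains the iterate played in round `t`; it
depends on `g 0, …, g (t - 1)` only. -/
def run {d : ℕ} (O : Oracles d) (η M : ℝ) (mNewton : ℕ) (wstar : E d) (g : ℕ → E d) :
    ℕ → Timed (State d)
  | 0 => start O wstar
  | t + 1 => do
    let S ← run O η M mNewton wstar g t
    playRound O η M mNewton S (g t)

/-- The state of BARONS at the beginning of round `t`. -/
def state {d : ℕ} (O : Oracles d) (η M : ℝ) (mNewton : ℕ) (wstar : E d) (g : ℕ → E d) (t : ℕ) :
    State d :=
  (run O η M mNewton wstar g t).val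

/-- The point played by BARONS in round `t`. -/
def iterate {d : ℕ} (O : Oracles d) (η M : ℝ) (mNewton : ℕ) (wstar : E d) (g : ℕ → E d) (t : ℕ) :
    E d :=
  (state O η M mNewton wstar g t).w

end BARONS

end

/-! BARONS is follow-the-regularized-leader carried out inexactly. Let z_t be the exact leader, the
point with ∇Φ(z_t) = -s_t, which minimizes Φ + ⟨s_t, ·⟩. Since z_{t+1} already takes g_t into
account, the be-the-leader inequality (`IsSelfConcordant.sum_inner_le`) bounds ∑ ⟨g_t, z_{t+1} - w⟩
by (Φ(w) - Φ(w*))/η. The rest of the regret is ∑ ⟨g_t, w_t - z_{t+1}⟩, at most the dual norm of g_t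
times the local distance from w_t to z_{t+1}, and that distance is O(ε + η‖g_t‖).

The distance is controlled by the geometry near a landmark u. Self-concordance bounds the derivative
of log(vᵀ∇²Φ v) along a segment, so the Hessian stays between (1 - 1/5)H and (1 + 1/5)H on the
H-ball of radius 1/(30M) about u (`IsLandmark.hessian_bounds`); the blow-up of Φ at the boundary
keeps this ball inside int K. On it x ↦ x - H⁻¹(∇Φ(x) + s) contracts by 1/5
(`IsLandmark.contraction`). This yields both the existence of the next leader within O(η‖g_t‖) of
the old one (`IsLandmark.exists_gradient_eq`) and the geometric convergence of the approximate
Newton steps down to error O(ε) (`IsLandmark.newtonLoop_le`), so logarithmically many steps suffice.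
`Invariant.playRound` combines these: the accuracy 4ε is restored after every round, even if H
changes.

Hessian calls are counted by the potential (number of calls) + 41M‖w_t - u_t‖_H. A round moves the
iterate by O(ε + η‖g_t‖); a recomputation happens only when 41M times the distance exceeds 1, and it
is paid for by the distance dropping to 0. -/

namespace BARONS

open Matrix Timed

/-! ### Local norms and bilinear forms of matrices -/

section LinearAlgebra

variable {d : ℕ}

/-- The bilinear form `(v, w) ↦ vᵀ A w`. -/
def form (A : Mat d) : LinearMap.BilinForm ℝ (E d) :=
  LinearMap.mk₂ ℝ (fun v w => v.ofLp ⬝ᵥ A.mulVec w.ofLp)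
    (fun _ _ _ => by simp [add_dotProduct])
    (fun _ _ _ => by simp)
    (fun _ _ _ => by simp [mulVec_add, dotProduct_add])
    (fun _ _ _ => by simp [mulVec_smul])

theorem form_apply (A : Mat d) (v w : E d) : form A v w = v.ofLp ⬝ᵥ A.mulVec w.ofLp := rfl

/-- The vector `A v`. -/
def act (A : Mat d) (v : E d) : E d := WithLp.toLp 2 (A.mulVec v.ofLp)

theorem inner_eq_dotProduct (v w : E d) : inner ℝ v w = v.ofLp ⬝ᵥ w.ofLp := by
  rw [EuclideanSpace.inner_eq_star_dotProduct, star_trivial, dotProduct_comm]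

theorem inner_act (A : Mat d) (v w : E d) : inner ℝ v (act A w) = form A v w := by
  rw [inner_eq_dotProduct]; rfl

theorem act_add (A : Mat d) (v w : E d) : act A (v + w) = act A v + act A w := by
  simp [act, mulVec_add]

theorem act_sub (A : Mat d) (v w : E d) : act A (v - w) = act A v - act A w := by
  simp [act, mulVec_sub]

theorem act_act (A B : Mat d) (v : E d) : act A (act B v) = act (A * B) v := by
  simp [act]

theorem act_one (v : E d) : act (1 : Mat d) v = v := by
  simp [act]

theorem form_sub_matrix (A B : Mat d) (v w : E d) : form (A - B) v w = form A v w - form B v w := by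
  simp [form_apply, sub_mulVec, dotProduct_sub]

theorem form_smul_matrix (c : ℝ) (A : Mat d) (v w : E d) : form (c • A) v w = c * form A v w := by
  simp [form_apply, smul_mulVec]

theorem form_nonneg {A : Mat d} (hA : A.PosSemidef) (v : E d) : 0 ≤ form A v v := by
  simpa [form_apply] using hA.dotProduct_mulVec_nonneg v.ofLp

theorem form_comm {A : Mat d} (hA : A.IsHermitian) (v w : E d) : form A v w = form A w v := by
  rw [form_apply, form_apply, dotProduct_mulVec, ← mulVec_transpose, dotProduct_comm]
  rw [show Aᵀ = A by simpa [IsHermitian] using hA]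

theorem form_pos {A : Mat d} (hA : A.PosDef) {v : E d} (hv : v ≠ 0) : 0 < form A v v := by
  have := hA.dotProduct_mulVec_pos (x := v.ofLp) (by simpa using hv)
  simpa [form_apply] using this

theorem form_le_of_le {A B : Mat d} (h : A ≤ B) (v : E d) : form A v v ≤ form B v v := by
  have := form_nonneg (Matrix.le_iff.mp h) v
  rw [form_sub_matrix] at this
  linarith

theorem localNorm_eq (A : Mat d) (v : E d) : localNorm A v = Real.sqrt (form A v v) := rfl

theorem localNorm_nonneg (A : Mat d) (v : E d) : 0 ≤ localNorm A v := Real.sqrt_nonneg _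

theorem localNorm_sq {A : Mat d} (hA : A.PosSemidef) (v : E d) :
    localNorm A v ^ 2 = form A v v := Real.sq_sqrt (form_nonneg hA v)

theorem localNorm_zero (A : Mat d) : localNorm A 0 = 0 := by
  simp [localNorm_eq]

theorem localNorm_neg (A : Mat d) (v : E d) : localNorm A (-v) = localNorm A v := by
  simp [localNorm_eq]

theorem localNorm_sub_comm (A : Mat d) (v w : E d) :
    localNorm A (v - w) = localNorm A (w - v) := by
  rw [← localNorm_neg, neg_sub]

theorem localNorm_smul (A : Mat d) (c : ℝ) (v : E d) :
    localNorm A (c • v) = |c| * localNorm A v := by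
  rw [localNorm_eq, localNorm_eq, ← Real.sqrt_sq_eq_abs, ← Real.sqrt_mul (sq_nonneg c)]
  congr 1
  simp
  ring

theorem form_sq_le {A : Mat d} (hA : A.PosSemidef) (v w : E d) :
    form A v w ^ 2 ≤ form A v v * form A w w :=
  LinearMap.BilinForm.apply_sq_le_of_symm _ (form_nonneg hA)
    ⟨fun v w => by simpa using form_comm hA.1 v w⟩ v w

theorem abs_form_le {A : Mat d} (hA : A.PosSemidef) (v w : E d) :
    |form A v w| ≤ localNorm A v * localNorm A w := by
  refine abs_le_of_sq_le_sq ?_ (mul_nonneg (localNorm_nonneg _ _) (localNorm_nonneg _ _))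
  rw [mul_pow, localNorm_sq hA, localNorm_sq hA]
  exact form_sq_le hA v w

theorem localNorm_add_le {A : Mat d} (hA : A.PosSemidef) (v w : E d) :
    localNorm A (v + w) ≤ localNorm A v + localNorm A w := by
  refine le_of_sq_le_sq ?_ (add_nonneg (localNorm_nonneg _ _) (localNorm_nonneg _ _))
  rw [add_sq, localNorm_sq hA, localNorm_sq hA, localNorm_sq hA]
  have h := (abs_le.mp (abs_form_le hA v w)).2
  have h2 := form_comm hA.1 w v
  simp only [map_add, LinearMap.add_apply]
  linarith

theorem localNorm_sub_le {A : Mat d} (hA : A.PosSemidef) (v w x : E d) :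
    localNorm A (v - x) ≤ localNorm A (v - w) + localNorm A (w - x) := by
  simpa using localNorm_add_le hA (v - w) (w - x)

theorem act_inv_left {A : Mat d} (hA : A.PosDef) (v : E d) : act A (act A⁻¹ v) = v := by
  rw [act_act, Matrix.mul_nonsing_inv _ ((Matrix.isUnit_iff_isUnit_det _).mp hA.isUnit), act_one]

/-- Duality of the local norms of `A` and of `A⁻¹`. -/
theorem abs_inner_le {A : Mat d} (hA : A.PosDef) (e v : E d) :
    |inner ℝ e v| ≤ localNorm A⁻¹ e * localNorm A v := by
  have h1 : inner ℝ e v = form A v (act A⁻¹ e) := by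
    rw [← inner_act, act_inv_left hA, real_inner_comm]
  have h2 : localNorm A (act A⁻¹ e) = localNorm A⁻¹ e := by
    rw [localNorm_eq, localNorm_eq, ← inner_act, act_inv_left hA, real_inner_comm, inner_act]
  rw [h1, ← h2, mul_comm]
  exact abs_form_le hA.posSemidef _ _

/-- A symmetric form that is close to `H` on the diagonal is close to `H` off the diagonal. -/
theorem abs_form_sub_le {A H : Mat d} (hH : H.PosSemidef) {θ : ℝ}
    (hl : (1 - θ) • H ≤ A) (hu : A ≤ (1 + θ) • H) (hθ : 0 ≤ θ) (v w : E d) :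
    |form H v w - form A v w| ≤ θ * localNorm H v * localNorm H w := by
  have hP := Matrix.le_iff.mp hl
  have hN := Matrix.le_iff.mp hu
  -- `H - A` is indefinite, so Cauchy–Schwarz does not apply to it directly. It is half the
  -- difference of two positive semidefinite forms whose sum is 2θH.
  have key : ∀ x y, form H x y - form A x y =
      (form ((1 + θ) • H - A) x y - form (A - (1 - θ) • H) x y) / 2 := by
    intro x y
    simp only [form_sub_matrix, form_smul_matrix]
    ring
  have hs : ∀ x, form ((1 + θ) • H - A) x x + form (A - (1 - θ) • H) x x =
      2 * θ * localNorm H x ^ 2 := by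
    intro x
    rw [localNorm_sq hH]
    simp only [form_sub_matrix, form_smul_matrix]
    ring
  have hp := form_sq_le hP v w
  have hn := form_sq_le hN v w
  have e1 := hs v
  have e2 := hs w
  have p1 := form_nonneg hP v
  have p2 := form_nonneg hP w
  have n1 := form_nonneg hN v
  have n2 := form_nonneg hN w
  rw [key]
  generalize form ((1 + θ) • H - A) v w = n at *
  generalize form (A - (1 - θ) • H) v w = p at *
  generalize form ((1 + θ) • H - A) v v = nv at *
  generalize form ((1 + θ) • H - A) w w = nw at *
  generalize form (A - (1 - θ) • H) v v = pv at *
  generalize form (A - (1 - θ) • H) w w = pw at *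
  refine abs_le_of_sq_le_sq ?_
    (mul_nonneg (mul_nonneg hθ (localNorm_nonneg _ _)) (localNorm_nonneg _ _))
  -- The cross term of (n - p)²: Cauchy–Schwarz for each form, then AM–GM.
  have h1 : |2 * (p * n)| ≤ pv * nw + nv * pw := by
    refine abs_le_of_sq_le_sq ?_ (by positivity)
    have : (p * n) ^ 2 ≤ (pv * pw) * (nv * nw) := by
      rw [mul_pow]; exact mul_le_mul hp hn (sq_nonneg _) (by positivity)
    nlinarith [sq_nonneg (pv * nw - nv * pw)]
  have h2 := (abs_le.mp h1).1
  have h3 : (nv + pv) * (nw + pw) = 4 * (θ * localNorm H v * localNorm H w) ^ 2 := by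
    rw [e1, e2]; ring
  nlinarith

theorem localNorm_le_of_le {A B : Mat d} {c : ℝ} (h : A ≤ c ^ 2 • B) (hc : 0 ≤ c) (v : E d) :
    localNorm A v ≤ c * localNorm B v := by
  have h1 := form_le_of_le h v
  rw [form_smul_matrix] at h1
  refine Real.sqrt_le_iff.mpr ⟨mul_nonneg hc (localNorm_nonneg _ _), h1.trans ?_⟩
  rw [mul_pow]
  gcongr
  -- `B` is arbitrary here; if its form is negative at `v`, it is still below the square of
  -- `Real.sqrt`.
  by_cases h : 0 ≤ form B v v
  · exact (Real.sq_sqrt h).ge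
  · exact (not_le.mp h).le.trans (sq_nonneg _)

theorem le_of_form_le {A B : Mat d} (hA : A.IsHermitian) (hB : B.IsHermitian)
    (h : ∀ v, form A v v ≤ form B v v) : A ≤ B := by
  refine Matrix.le_iff.mpr (.of_dotProduct_mulVec_nonneg (hB.sub hA) fun x => ?_)
  have := h (WithLp.toLp 2 x)
  rw [← sub_nonneg, ← form_sub_matrix, form_apply] at this
  simpa using this

theorem posDef_of_form_pos {A : Mat d} (hA : A.IsHermitian) (h : ∀ v, v ≠ 0 → 0 < form A v v) :
    A.PosDef := by
  refine .of_dotProduct_mulVec_pos hA fun x hx => ?_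
  have := h (WithLp.toLp 2 x) (by simpa using hx)
  rw [form_apply] at this
  simpa using this

end LinearAlgebra

/-! ### Derivatives along lines -/

section Derivatives

variable {d : ℕ} {f : E d → ℝ} {x : E d}

/-- The second derivative as a bilinear map. -/
noncomputable abbrev D2 (f : E d → ℝ) (x : E d) : E d →L[ℝ] E d →L[ℝ] ℝ := fderiv ℝ (fderiv ℝ f) x

/-- The third derivative as a trilinear map. -/
noncomputable abbrev D3 (f : E d → ℝ) (x : E d) : E d →L[ℝ] E d →L[ℝ] E d →L[ℝ] ℝ :=
  fderiv ℝ (fderiv ℝ (fderiv ℝ f)) x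

theorem form_hessian (f : E d → ℝ) (x v w : E d) : form (hessian f x) v w = D2 f x v w := by
  have h : ∀ v : E d, v = ∑ i, v i • EuclideanSpace.single i (1 : ℝ) := fun v => by
    have := (EuclideanSpace.basisFun (Fin d) ℝ).sum_repr v
    simpa using this.symm
  conv_rhs => rw [h v, h w]
  simp only [map_sum, map_smul, _root_.sum_apply, _root_.smul_apply,
    smul_eq_mul, form_apply, dotProduct, mulVec, hessian, iteratedFDeriv_two_apply, Matrix.of_apply,
    Matrix.cons_val_zero, Matrix.cons_val_one]
  simp only [Finset.mul_sum]
  rw [Finset.sum_comm]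
  exact Finset.sum_congr rfl fun i _ => Finset.sum_congr rfl fun j _ => by ring

theorem iteratedFDeriv_three_apply (f : E d → ℝ) (x u : E d) :
    iteratedFDeriv ℝ 3 f x (fun _ => u) = D3 f x u u u := by
  rw [iteratedFDeriv_succ_apply_right, iteratedFDeriv_two_apply]
  rfl

theorem D2_comm (hf : ContDiffAt ℝ 3 f x) (v w : E d) : D2 f x v w = D2 f x w v :=
  (hf.isSymmSndFDerivAt (by simp; norm_num)).eq v w

theorem hessian_isHermitian (hf : ContDiffAt ℝ 3 f x) : (hessian f x).IsHermitian := by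
  ext i j
  simp only [conjTranspose_apply, star_trivial, hessian, Matrix.of_apply, iteratedFDeriv_two_apply,
    Matrix.cons_val_zero, Matrix.cons_val_one]
  exact D2_comm hf _ _

theorem hasFDerivAt_of_contDiffAt (hf : ContDiffAt ℝ 3 f x) : HasFDerivAt f (fderiv ℝ f x) x :=
  (hf.differentiableAt (by norm_num)).hasFDerivAt

theorem hasFDerivAt_fderiv (hf : ContDiffAt ℝ 3 f x) : HasFDerivAt (fderiv ℝ f) (D2 f x) x :=
  ((hf.fderiv_right (m := 2) (by norm_num)).differentiableAt (by norm_num)).hasFDerivAt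

theorem hasFDerivAt_D2 (hf : ContDiffAt ℝ 3 f x) : HasFDerivAt (D2 f) (D3 f x) x :=
  (((hf.fderiv_right (m := 2) (by norm_num)).fderiv_right (m := 1)
    (by norm_num)).differentiableAt (by norm_num)).hasFDerivAt

theorem hasDerivAt_line {V : Type*} [NormedAddCommGroup V] [NormedSpace ℝ V] (x h : V) (t : ℝ) :
    HasDerivAt (fun s : ℝ => x + s • h) h t := by
  simpa using ((hasDerivAt_id t).smul_const h).const_add x

theorem HasFDerivAt.comp_line {V F : Type*} [NormedAddCommGroup V] [NormedSpace ℝ V]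
    [NormedAddCommGroup F] [NormedSpace ℝ F] {g : V → F} {g' : V →L[ℝ] F} {x h : V} {t : ℝ}
    (hg : HasFDerivAt g g' (x + t • h)) : HasDerivAt (fun s : ℝ => g (x + s • h)) (g' h) t :=
  hg.comp_hasDerivAt t (hasDerivAt_line x h t)

theorem hasDerivAt_clm_apply_const {F G : Type*} [NormedAddCommGroup F] [NormedSpace ℝ F]
    [NormedAddCommGroup G] [NormedSpace ℝ G] {c : ℝ → F →L[ℝ] G} {c' : F →L[ℝ] G} {t : ℝ}
    (hc : HasDerivAt c c' t) (v : F) : HasDerivAt (fun s => c s v) (c' v) t := by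
  simpa using hc.clm_apply (hasDerivAt_const t v)

theorem hasDerivAt_comp_line {h : E d} {t : ℝ} (hf : ContDiffAt ℝ 3 f (x + t • h)) :
    HasDerivAt (fun s : ℝ => f (x + s • h)) (fderiv ℝ f (x + t • h) h) t :=
  HasFDerivAt.comp_line (hasFDerivAt_of_contDiffAt hf)

theorem hasDerivAt_fderiv_line {h : E d} {t : ℝ} (hf : ContDiffAt ℝ 3 f (x + t • h)) (v : E d) :
    HasDerivAt (fun s : ℝ => fderiv ℝ f (x + s • h) v) (D2 f (x + t • h) h v) t := by
  have h1 := HasFDerivAt.comp_line (hasFDerivAt_fderiv hf)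
  exact hasDerivAt_clm_apply_const h1 v

theorem hasDerivAt_D2_line {h : E d} {t : ℝ} (hf : ContDiffAt ℝ 3 f (x + t • h)) (v w : E d) :
    HasDerivAt (fun s : ℝ => D2 f (x + s • h) v w) (D3 f (x + t • h) h v w) t := by
  have h1 := HasFDerivAt.comp_line (g := D2 f) (x := x) (h := h) (t := t) (hasFDerivAt_D2 hf)
  have h2 := hasDerivAt_clm_apply_const h1 v
  exact hasDerivAt_clm_apply_const h2 w

theorem D3_comm_left (hf : ContDiffAt ℝ 3 f x) (a b c : E d) : D3 f x a b c = D3 f x b a c := by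
  have h := ((hf.fderiv_right (m := 2) (by norm_num)).isSymmSndFDerivAt
    (by simp)).eq a b
  exact congrArg (fun L : E d →L[ℝ] ℝ => L c) h

/-- Differentiate the symmetry of the second derivative in the direction `a`; both sides agree near
`x`. -/
theorem D3_comm_right (hf : ContDiffAt ℝ 3 f x) (a b c : E d) : D3 f x a b c = D3 f x a c b := by
  have h0 : x + (0 : ℝ) • a = x := by simp
  have h1 := hasDerivAt_D2_line (x := x) (h := a) (t := 0) (by rwa [h0]) b c
  have h2 := hasDerivAt_D2_line (x := x) (h := a) (t := 0) (by rwa [h0]) c b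
  rw [h0] at h1 h2
  refine h1.unique (h2.congr_of_eventuallyEq ?_)
  have hc : ∀ᶠ y in nhds x, ContDiffAt ℝ 3 f y := hf.eventually (by simp)
  have ht : Filter.Tendsto (fun s : ℝ => x + s • a) (nhds 0) (nhds x) := by
    have := (hasDerivAt_line x a 0).continuousAt.tendsto
    rwa [h0] at this
  filter_upwards [ht.eventually hc] with s hs using D2_comm hs b c

/-- A symmetric trilinear form bounded by the cube of a norm on the diagonal is bounded off the
diagonal, with a loss of `5 / 3`. -/
theorem abs_D3_le {M : ℝ} (hf : ContDiffAt ℝ 3 f x) (hQ : (hessian f x).PosDef)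
    (h3 : ∀ u, |D3 f x u u u| ≤ 2 * M * localNorm (hessian f x) u ^ 3) (hM : 0 ≤ M) (h v : E d) :
    |D3 f x h v v| ≤ 10 / 3 * M * localNorm (hessian f x) h * form (hessian f x) v v := by
  set Q := hessian f x with hQdef
  have unit : ∀ h v : E d, localNorm Q h = 1 → localNorm Q v = 1 →
      |D3 f x h v v| ≤ 10 / 3 * M := by
    intro h v hh hv
    have e1 := h3 (h + v)
    have e2 := h3 (h - v)
    have e3 := h3 h
    -- Polarization. With the parallelogram law for unit `h`, `v`, the left side is at most 16M and
    -- the term in `h` alone at most 4M, whence 20M/6 = 10M/3.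
    have i1 : D3 f x (h + v) (h + v) (h + v) + D3 f x (h - v) (h - v) (h - v) =
        2 * D3 f x h h h + 6 * D3 f x h v v := by
      simp only [map_add, map_sub, _root_.add_apply, _root_.sub_apply]
      rw [D3_comm_left hf v h v, D3_comm_right hf v v h, D3_comm_left hf v h v]
      ring
    have s1 : localNorm Q (h + v) ^ 2 + localNorm Q (h - v) ^ 2 = 4 := by
      have a := localNorm_sq hQ.posSemidef h
      have b := localNorm_sq hQ.posSemidef v
      rw [hh] at a
      rw [hv] at b
      rw [localNorm_sq hQ.posSemidef, localNorm_sq hQ.posSemidef]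
      simp only [map_add, map_sub, LinearMap.add_apply, LinearMap.sub_apply]
      linarith
    have n1 := localNorm_nonneg Q (h + v)
    have n2 := localNorm_nonneg Q (h - v)
    have m1 : localNorm Q (h + v) ≤ 2 := by nlinarith [sq_nonneg (localNorm Q (h - v))]
    have m2 : localNorm Q (h - v) ≤ 2 := by nlinarith [sq_nonneg (localNorm Q (h + v))]
    have c1 : localNorm Q (h + v) ^ 3 ≤ 2 * localNorm Q (h + v) ^ 2 := by
      rw [pow_succ']; gcongr
    have c2 : localNorm Q (h - v) ^ 3 ≤ 2 * localNorm Q (h - v) ^ 2 := by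
      rw [pow_succ']; gcongr
    have c3 : 2 * M * localNorm Q (h + v) ^ 3 + 2 * M * localNorm Q (h - v) ^ 3 ≤ 16 * M := by
      nlinarith
    rw [hh] at e3
    rw [abs_le] at e1 e2 e3 ⊢
    constructor <;> linarith
  have homog : ∀ (a b : ℝ) (h v : E d), D3 f x (a • h) (b • v) (b • v) =
      a * b ^ 2 * D3 f x h v v := by
    intro a b h v
    simp only [map_smul, _root_.smul_apply, smul_eq_mul]
    ring
  by_cases hh : h = 0
  · simp [hh, localNorm_zero]
  by_cases hv : v = 0
  · simp [hv]
  have ph : 0 < localNorm Q h := Real.sqrt_pos.mpr (form_pos hQ hh)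
  have pv : 0 < localNorm Q v := Real.sqrt_pos.mpr (form_pos hQ hv)
  have := unit ((localNorm Q h)⁻¹ • h) ((localNorm Q v)⁻¹ • v)
    (by rw [localNorm_smul, abs_of_pos (by positivity)]; field_simp)
    (by rw [localNorm_smul, abs_of_pos (by positivity)]; field_simp)
  rw [homog, abs_mul, abs_of_pos (by positivity)] at this
  rw [← localNorm_sq hQ.posSemidef]
  field_simp at this
  linarith

end Derivatives

/-! ### Self-concordant functions -/

/-- A nonnegative function with `|q'| ≤ 2 M q^{3/2}` grows at most like the solution of the
equation with equality. -/
theorem sqrt_le_of_abs_deriv_le {q q' : ℝ → ℝ} {M ρ τ : ℝ} (hτ : 0 ≤ τ)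
    (hd : ∀ t ∈ Set.Icc 0 τ, HasDerivAt q (q' t) t) (hq : ∀ t ∈ Set.Icc 0 τ, 0 ≤ q t)
    (hq' : ∀ t ∈ Set.Icc 0 τ, |q' t| ≤ 2 * M * Real.sqrt (q t) ^ 3) (hM : 0 ≤ M)
    (hρ : 0 < ρ) (h0 : q 0 < ρ ^ 2) (hMρ : M * ρ * τ < 1) :
    Real.sqrt (q τ) ≤ ρ / (1 - M * ρ * τ) := by
  -- The function (q + δ)^(-1/2) has derivative at most M in absolute value. The shift δ > 0 allows
  -- zeros of `q` and makes the initial value exactly 1/ρ.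
  set δ := ρ ^ 2 - q 0 with hδ
  have hδ0 : 0 < δ := by rw [hδ]; linarith
  have hs : ∀ t ∈ Set.Icc 0 τ, 0 < Real.sqrt (q t + δ) := fun t ht =>
    Real.sqrt_pos.mpr (by linarith [hq t ht])
  have hp : ∀ t ∈ Set.Icc 0 τ, HasDerivWithinAt (fun t => (Real.sqrt (q t + δ))⁻¹)
      (-(q' t / (2 * Real.sqrt (q t + δ))) / Real.sqrt (q t + δ) ^ 2) (Set.Icc 0 τ) t := by
    intro t ht
    have h1 := ((hd t ht).add_const δ).sqrt (by linarith [hq t ht])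
    exact (h1.inv (hs t ht).ne').hasDerivWithinAt
  have hb : ∀ t ∈ Set.Ico 0 τ,
      ‖-(q' t / (2 * Real.sqrt (q t + δ))) / Real.sqrt (q t + δ) ^ 2‖ ≤ M := by
    intro t ht'
    have ht := Set.Ico_subset_Icc_self ht'
    have h1 := hs t ht
    rw [Real.norm_eq_abs, abs_div, abs_neg, abs_div, abs_of_pos (pow_pos h1 2),
      abs_of_pos (mul_pos two_pos h1), div_div, div_le_iff₀ (by positivity)]
    have h2 : Real.sqrt (q t) ≤ Real.sqrt (q t + δ) := Real.sqrt_le_sqrt (by linarith)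
    calc |q' t| ≤ 2 * M * Real.sqrt (q t) ^ 3 := hq' t ht
      _ ≤ 2 * M * Real.sqrt (q t + δ) ^ 3 := by gcongr
      _ = _ := by ring
  have key := norm_image_sub_le_of_norm_deriv_le_segment' hp hb τ ⟨hτ, le_rfl⟩
  have hρ' : Real.sqrt (q 0 + δ) = ρ := by
    rw [show q 0 + δ = ρ ^ 2 by rw [hδ]; ring, Real.sqrt_sq hρ.le]
  simp only [hρ', Real.norm_eq_abs, sub_zero] at key
  have h1 := (abs_le.mp key).1
  have h2 : (1 - M * ρ * τ) / ρ ≤ (Real.sqrt (q τ + δ))⁻¹ := by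
    rw [sub_div, one_div, show M * ρ * τ / ρ = M * τ by field_simp]
    linarith
  have h3 : 0 < 1 - M * ρ * τ := by linarith
  calc Real.sqrt (q τ) ≤ Real.sqrt (q τ + δ) := Real.sqrt_le_sqrt (by linarith)
    _ = ((Real.sqrt (q τ + δ))⁻¹)⁻¹ := (inv_inv _).symm
    _ ≤ ((1 - M * ρ * τ) / ρ)⁻¹ := by gcongr
    _ = _ := inv_div _ _

namespace IsSelfConcordant

variable {d : ℕ} {K : Set (E d)} {Φ : E d → ℝ} {M : ℝ}

theorem convex (hΦ : IsSelfConcordant K Φ M) : Convex ℝ (interior K) := hΦ.convexOn.1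

theorem contDiffAt (hΦ : IsSelfConcordant K Φ M) {x : E d} (hx : x ∈ interior K) :
    ContDiffAt ℝ 3 Φ x :=
  hΦ.contDiffOn.contDiffAt (isOpen_interior.mem_nhds hx)

theorem line_mem (hΦ : IsSelfConcordant K Φ M) {x h : E d} (hx : x ∈ interior K) {t s : ℝ}
    (ht : x + t • h ∈ interior K) (hs : s ∈ Set.Icc 0 t) : x + s • h ∈ interior K := by
  obtain rfl | ht0 := (hs.1.trans hs.2).eq_or_lt
  · rwa [le_antisymm hs.2 hs.1]
  have := hΦ.convex.add_smul_sub_mem hx ht (t := s / t)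
    ⟨div_nonneg hs.1 ht0.le, (div_le_one ht0).mpr hs.2⟩
  rwa [add_sub_cancel_left, smul_smul, div_mul_cancel₀ _ ht0.ne'] at this

/-- The first-order characterization of convexity. -/
theorem add_fderiv_le (hΦ : IsSelfConcordant K Φ M) {x y : E d} (hx : x ∈ interior K)
    (hy : y ∈ interior K) : Φ x + fderiv ℝ Φ x (y - x) ≤ Φ y := by
  have hc : ConvexOn ℝ (Set.Icc (0 : ℝ) 1) (fun t : ℝ => Φ (x + t • (y - x))) := by
    refine ⟨convex_Icc 0 1, fun a ha b hb p q hp hq hpq => ?_⟩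
    have e : x + (p • a + q • b) • (y - x) = p • (x + a • (y - x)) + q • (x + b • (y - x)) := by
      obtain rfl : p = 1 - q := by linarith
      simp only [smul_eq_mul]
      module
    have hy' : x + (1 : ℝ) • (y - x) ∈ interior K := by simpa
    beta_reduce
    rw [e]
    exact hΦ.convexOn.2 (hΦ.line_mem hx hy' ha) (hΦ.line_mem hx hy' hb) hp hq hpq
  have hd := hasDerivAt_comp_line (f := Φ) (x := x) (h := y - x) (t := 0)
    (by simpa using hΦ.contDiffAt hx)
  have := hc.le_slope_of_hasDerivAt (x := 0) (y := 1) (by simp) (by simp) one_pos hd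
  simp [slope] at this
  rw [map_sub]
  linarith

/-- Adding the first-order inequalities at `x` and at `x + s • v` shows that the derivative in
direction `v` does not decrease, so its right difference quotients are nonnegative. -/
theorem hessian_posSemidef (hΦ : IsSelfConcordant K Φ M) {x : E d} (hx : x ∈ interior K) :
    (hessian Φ x).PosSemidef := by
  have key : ∀ v : E d, 0 ≤ D2 Φ x v v := by
    intro v
    have hd := hasDerivAt_fderiv_line (f := Φ) (x := x) (h := v) (t := 0)
      (by simpa using hΦ.contDiffAt hx) v
    have ht := hd.tendsto_slope_zero_right
    have e : D2 Φ (x + (0 : ℝ) • v) v v = D2 Φ x v v := by simp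
    rw [e] at ht
    refine ge_of_tendsto ht ?_
    have hc : Filter.Tendsto (fun s : ℝ => x + s • v) (nhdsWithin 0 (Set.Ioi 0)) (nhds x) := by
      have := (hasDerivAt_line x v 0).continuousAt.tendsto
      simp only [zero_smul, add_zero] at this
      exact this.mono_left nhdsWithin_le_nhds
    filter_upwards [hc.eventually (isOpen_interior.mem_nhds hx), self_mem_nhdsWithin] with s hs hs0
    have hs0 : 0 < s := hs0
    have h1 := hΦ.add_fderiv_le hx hs
    have h2 := hΦ.add_fderiv_le hs hx
    simp only [add_sub_cancel_left, sub_add_cancel_left, map_neg, map_smul, smul_eq_mul] at h1 h2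
    simp only [zero_add, zero_smul, add_zero, smul_eq_mul]
    refine mul_nonneg (inv_nonneg.mpr hs0.le) ?_
    nlinarith
  refine .of_dotProduct_mulVec_nonneg (hessian_isHermitian (hΦ.contDiffAt hx)) fun v => ?_
  have := key (WithLp.toLp 2 v)
  rw [← form_hessian, form_apply] at this
  simpa using this

theorem sq_localNorm_hessian (hΦ : IsSelfConcordant K Φ M) {x : E d} (hx : x ∈ interior K)
    (v : E d) : localNorm (hessian Φ x) v ^ 2 = D2 Φ x v v := by
  rw [localNorm_sq (hΦ.hessian_posSemidef hx), form_hessian]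

theorem abs_D3_diag_le (hΦ : IsSelfConcordant K Φ M) {x : E d} (hx : x ∈ interior K) (u : E d) :
    |D3 Φ x u u u| ≤ 2 * M * localNorm (hessian Φ x) u ^ 3 := by
  rw [← iteratedFDeriv_three_apply]
  exact hΦ.third_deriv_le x hx u

/-- A segment along which the second derivative stays bounded does not leave `int K`. -/
theorem mem_interior_of_D2_le (hΦ : IsSelfConcordant K Φ M) {x h : E d} (hx : x ∈ interior K)
    {C : ℝ} (hC : ∀ t ∈ Set.Icc (0 : ℝ) 1, x + t • h ∈ interior K → D2 Φ (x + t • h) h h ≤ C) :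
    x + h ∈ interior K := by
  by_contra hxh
  have hcont : Continuous fun t : ℝ => x + t • h := by fun_prop
  -- The infimum of the exit times is attained, since `S` is closed, and the segment lies in the
  -- interior before it.
  set S : Set ℝ := Set.Icc 0 1 ∩ (fun t : ℝ => x + t • h) ⁻¹' (interior K)ᶜ with hS
  have hSc : IsClosed S := isClosed_Icc.inter (isOpen_interior.isClosed_compl.preimage hcont)
  have hSb : BddBelow S := ⟨0, fun t ht => ht.1.1⟩
  have hSn : S.Nonempty := ⟨1, by simp, by simpa using hxh⟩
  have hτ : sInf S ∈ S := hSc.csInf_mem hSn hSb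
  set τ := sInf S
  have hin : ∀ t, 0 ≤ t → t < τ → x + t • h ∈ interior K := by
    intro t h0 ht
    by_contra hn
    exact (csInf_le hSb ⟨⟨h0, ht.le.trans hτ.1.2⟩, hn⟩).not_gt ht
  have hτ0 : 0 < τ := by
    refine hτ.1.1.lt_of_ne fun h0 => hτ.2 ?_
    simpa [← h0] using hx
  have hC0 : 0 ≤ C := by
    refine le_trans ?_ (hC 0 (by simp) (by simpa using hx))
    rw [← hΦ.sq_localNorm_hessian (by simpa using hx)]
    positivity
  -- Integrating the bound on the second derivative once bounds the slope by `B`, and twice bounds Φ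
  -- by Φ(x) + B up to the exit. This contradicts the blow-up at the frontier.
  set B := |fderiv ℝ Φ x h| + C with hB
  have hd1 : ∀ t, 0 ≤ t → t < τ → |fderiv ℝ Φ (x + t • h) h| ≤ B := by
    intro t h0 ht
    have := norm_image_sub_le_of_norm_deriv_le_segment' (f := fun s => fderiv ℝ Φ (x + s • h) h)
      (a := 0) (b := t) (C := C)
      (fun s hs => (hasDerivAt_fderiv_line (hΦ.contDiffAt
        (hin s hs.1 (hs.2.trans_lt ht))) h).hasDerivWithinAt)
      (fun s hs => by
        have hm := hin s hs.1 (hs.2.trans ht)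
        rw [Real.norm_eq_abs, abs_of_nonneg]
        · exact hC s ⟨hs.1, (hs.2.trans ht).le.trans hτ.1.2⟩ hm
        · rw [← hΦ.sq_localNorm_hessian hm]; positivity)
      t ⟨h0, le_rfl⟩
    simp only [zero_smul, add_zero, sub_zero, Real.norm_eq_abs] at this
    have h2 := abs_sub_abs_le_abs_sub (fderiv ℝ Φ (x + t • h) h) (fderiv ℝ Φ x h)
    have h3 : C * t ≤ C * 1 := mul_le_mul_of_nonneg_left (ht.le.trans hτ.1.2) hC0
    linarith
  have hd0 : ∀ t, 0 ≤ t → t < τ → Φ (x + t • h) ≤ Φ x + B := by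
    intro t h0 ht
    have := norm_image_sub_le_of_norm_deriv_le_segment' (f := fun s => Φ (x + s • h))
      (a := 0) (b := t) (C := B)
      (fun s hs => (hasDerivAt_comp_line (hΦ.contDiffAt
        (hin s hs.1 (hs.2.trans_lt ht)))).hasDerivWithinAt)
      (fun s hs => hd1 s hs.1 (hs.2.trans ht)) t ⟨h0, le_rfl⟩
    simp only [zero_smul, add_zero, sub_zero, Real.norm_eq_abs] at this
    have h3 : B * t ≤ B * 1 :=
      mul_le_mul_of_nonneg_left (ht.le.trans hτ.1.2) (by positivity)
    linarith [(abs_le.mp this).2]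
  have hIco : ∀ᶠ t in nhdsWithin τ (Set.Iio τ), t ∈ Set.Ico 0 τ := Ico_mem_nhdsLT hτ0
  have htend : Filter.Tendsto (fun t : ℝ => x + t • h) (nhdsWithin τ (Set.Iio τ))
      (nhdsWithin (x + τ • h) (interior K)) := by
    refine tendsto_nhdsWithin_iff.mpr ⟨hcont.continuousAt.tendsto.mono_left nhdsWithin_le_nhds, ?_⟩
    filter_upwards [hIco] with t ht using hin t ht.1 ht.2
  have hfr : x + τ • h ∈ frontier K := by
    refine ⟨closure_mono interior_subset ?_, hτ.2⟩
    refine mem_closure_of_tendsto (htend.mono_right nhdsWithin_le_nhds) ?_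
    filter_upwards [hIco] with t ht using hin t ht.1 ht.2
  have hinf := (hΦ.tendsto_frontier _ hfr).comp htend
  obtain ⟨t, ht, hgt⟩ := (hIco.and (hinf.eventually_gt_atTop (Φ x + B))).exists
  exact (hd0 t ht.1 ht.2).not_gt hgt

/-- In the direction of the line itself, self-concordance is the scalar inequality |q'| ≤ 2M q^{3/2}
for q(t) = ∇²Φ(x + th)[h, h]. -/
theorem localNorm_line_le (hΦ : IsSelfConcordant K Φ M) {x h : E d} (hx : x ∈ interior K)
    {ρ t : ℝ} (ht : t ∈ Set.Icc (0 : ℝ) 1) (hth : x + t • h ∈ interior K)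
    (hρ : localNorm (hessian Φ x) h < ρ) (hMρ : M * ρ < 1) :
    localNorm (hessian Φ (x + t • h)) h ≤ ρ / (1 - M * ρ) := by
  have hρ0 : 0 < ρ := (localNorm_nonneg _ _).trans_lt hρ
  have hMρ0 := mul_nonneg hΦ.nonneg hρ0.le
  have hm : ∀ s ∈ Set.Icc 0 t, x + s • h ∈ interior K := fun s hs => hΦ.line_mem hx hth hs
  have hle : M * ρ * t ≤ M * ρ := mul_le_of_le_one_right hMρ0 ht.2
  have hsq : ∀ s ∈ Set.Icc 0 t, Real.sqrt (D2 Φ (x + s • h) h h) =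
      localNorm (hessian Φ (x + s • h)) h := fun s hs => by
    rw [← hΦ.sq_localNorm_hessian (hm s hs), Real.sqrt_sq (localNorm_nonneg _ _)]
  have key := sqrt_le_of_abs_deriv_le (q := fun s => D2 Φ (x + s • h) h h) (M := M) (ρ := ρ)
    (τ := t) ht.1
    (fun s hs => hasDerivAt_D2_line (hΦ.contDiffAt (hm s hs)) h h)
    (fun s hs => by rw [← hΦ.sq_localNorm_hessian (hm s hs)]; positivity)
    (fun s hs => by rw [hsq s hs]; exact hΦ.abs_D3_diag_le (hm s hs) h)
    hΦ.nonneg hρ0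
    (by
      simp only [zero_smul, add_zero]
      rw [← hΦ.sq_localNorm_hessian hx]
      exact pow_lt_pow_left₀ hρ (localNorm_nonneg _ _) two_ne_zero)
    (by linarith)
  rw [hsq t ⟨ht.1, le_rfl⟩] at key
  refine key.trans ?_
  have : 0 < 1 - M * ρ := by linarith
  gcongr

/-- The Dikin ellipsoid at `x` is contained in `int K`. -/
theorem mem_interior_of_localNorm_lt (hΦ : IsSelfConcordant K Φ M) {x h : E d}
    (hx : x ∈ interior K) {ρ : ℝ} (hρ : localNorm (hessian Φ x) h < ρ) (hMρ : M * ρ < 1) :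
    x + h ∈ interior K := by
  refine hΦ.mem_interior_of_D2_le hx (C := (ρ / (1 - M * ρ)) ^ 2) fun t ht hm => ?_
  rw [← hΦ.sq_localNorm_hessian hm]
  exact pow_le_pow_left₀ (localNorm_nonneg _ _) (hΦ.localNorm_line_le hx ht hm hρ hMρ) 2

/-- A null direction of the Hessian has local norm 0, so the Dikin ellipsoid would contain a whole
line, which the bounded set `K` cannot. -/
theorem hessian_posDef (hΦ : IsSelfConcordant K Φ M) (hK : IsCompact K) {x : E d}
    (hx : x ∈ interior K) : (hessian Φ x).PosDef := by
  have hQ := hΦ.hessian_posSemidef hx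
  refine posDef_of_form_pos hQ.1 fun v hv => (form_nonneg hQ v).lt_of_ne fun h0 => ?_
  have hline : ∀ s : ℝ, x + s • v ∈ K := by
    intro s
    have hM : 0 < M + 1 := by linarith [hΦ.nonneg]
    refine interior_subset (hΦ.mem_interior_of_localNorm_lt hx (ρ := 1 / (M + 1)) ?_ ?_)
    · rw [localNorm_smul, localNorm_eq, ← h0]
      simpa using hM
    · rw [mul_one_div, div_lt_one hM]
      linarith
  obtain ⟨R, hR⟩ := hK.isBounded.exists_norm_le
  have hv' : 0 < ‖v‖ := norm_pos_iff.mpr hv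
  have h1 := hR _ (hline ((R + ‖x‖ + 1) / ‖v‖))
  have h2 := norm_sub_norm_le (((R + ‖x‖ + 1) / ‖v‖) • v) (-x)
  have hR0 : 0 ≤ R := (norm_nonneg _).trans (hR x (interior_subset hx))
  rw [norm_smul, Real.norm_eq_abs, abs_of_nonneg (by positivity), div_mul_cancel₀ _ hv'.ne',
    norm_neg, sub_neg_eq_add, add_comm _ x] at h2
  linarith

/-- Stability of the Hessian inside the Dikin ellipsoid. -/
theorem abs_log_form_sub_le (hΦ : IsSelfConcordant K Φ M) (hK : IsCompact K) {x h : E d}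
    (hx : x ∈ interior K) {ρ : ℝ} (hρ : localNorm (hessian Φ x) h < ρ) (hMρ : M * ρ < 1)
    {v : E d} (hv : v ≠ 0) :
    |Real.log (form (hessian Φ (x + h)) v v) - Real.log (form (hessian Φ x) v v)| ≤
      10 / 3 * M * (ρ / (1 - M * ρ)) := by
  have hm : ∀ t ∈ Set.Icc (0 : ℝ) 1, x + t • h ∈ interior K := fun t ht =>
    hΦ.line_mem hx (t := 1) (by simpa using hΦ.mem_interior_of_localNorm_lt hx hρ hMρ) ht
  have hpos : ∀ t ∈ Set.Icc (0 : ℝ) 1, 0 < D2 Φ (x + t • h) v v := fun t ht => by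
    rw [← form_hessian]
    exact form_pos (hΦ.hessian_posDef hK (hm t ht)) hv
  -- The logarithmic derivative is D³Φ[h, v, v] / D²Φ[v, v]; the mixed bound `abs_D3_le` cancels the
  -- dependence on `v`.
  have key := norm_image_sub_le_of_norm_deriv_le_segment_01'
    (f := fun t => Real.log (D2 Φ (x + t • h) v v))
    (C := 10 / 3 * M * (ρ / (1 - M * ρ)))
    (fun t ht => ((hasDerivAt_D2_line (hΦ.contDiffAt (hm t ht)) v v).log
      (hpos t ht).ne').hasDerivWithinAt)
    (fun t ht' => by
      have ht := Set.Ico_subset_Icc_self ht'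
      rw [Real.norm_eq_abs, abs_div, abs_of_pos (hpos t ht), div_le_iff₀ (hpos t ht)]
      refine (abs_D3_le (hΦ.contDiffAt (hm t ht)) (hΦ.hessian_posDef hK (hm t ht))
        (hΦ.abs_D3_diag_le (hm t ht)) hΦ.nonneg h v).trans ?_
      rw [form_hessian]
      have h1 := hΦ.localNorm_line_le hx ht (hm t ht) hρ hMρ
      have h2 := hΦ.nonneg
      have h3 := (hpos t ht).le
      gcongr)
  simp only [one_smul, zero_smul, add_zero, Real.norm_eq_abs] at key
  rwa [form_hessian, form_hessian]

end IsSelfConcordant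

/-! ### Approximate Newton steps near a landmark -/

section Landmark

variable {d : ℕ} {K : Set (E d)} {Φ : E d → ℝ} {M : ℝ}

/-- `u ∈ int K` is a landmark, and `H`, with inverse `G`, approximates the Hessian there. -/
structure IsLandmark (K : Set (E d)) (Φ : E d → ℝ) (u : E d) (H G : Mat d) : Prop where
  mem : u ∈ interior K
  mul_eq_one : H * G = 1
  lower : (1 - 0.001 : ℝ) • hessian Φ u ≤ H
  upper : H ≤ (1 + 0.001 : ℝ) • hessian Φ u

theorem IsHessOracle.isLandmark {O : E d → Mat d × Mat d} (hO : IsHessOracle K Φ 0.001 O) {u : E d}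
    (hu : u ∈ interior K) : IsLandmark K Φ u (O u).1 (O u).2 :=
  ⟨hu, (hO u hu).1, (hO u hu).2.1, (hO u hu).2.2.1⟩

variable {u : E d} {H G : Mat d}

theorem smul_isHermitian {A : Mat d} (hA : A.IsHermitian) (c : ℝ) : (c • A).IsHermitian := by
  simp only [IsHermitian, conjTranspose_smul, star_trivial] at hA ⊢
  rw [hA]

theorem IsLandmark.posDef (hu : IsLandmark K Φ u H G) (hΦ : IsSelfConcordant K Φ M)
    (hK : IsCompact K) : H.PosDef := by
  have hQ := hΦ.hessian_posDef hK hu.mem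
  have hherm : H.IsHermitian := by
    simpa using (Matrix.le_iff.mp hu.lower).1.add (smul_isHermitian hQ.1 (1 - 0.001))
  refine posDef_of_form_pos hherm fun v hv => ?_
  have h1 := form_le_of_le hu.lower v
  have h2 := form_pos hQ hv
  rw [form_smul_matrix] at h1
  norm_num at h1
  linarith

/-- In the ball of radius `1 / (30 M)` around a landmark the Hessian is close to its
approximation. -/
theorem IsLandmark.hessian_bounds (hu : IsLandmark K Φ u H G) (hΦ : IsSelfConcordant K Φ M)
    (hK : IsCompact K) (hM : 0 < M) {z : E d} (hz : localNorm H (z - u) ≤ 1 / (30 * M)) :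
    z ∈ interior K ∧ (1 - 1 / 5 : ℝ) • H ≤ hessian Φ z ∧ hessian Φ z ≤ (1 + 1 / 5 : ℝ) • H := by
  have hQ := hΦ.hessian_posDef hK hu.mem
  have hH := hu.posDef hΦ hK
  -- Passing from `H` to the true Hessian costs a factor 1/0.999 in the square, and 29² < 0.999 ·
  -- 30².
  have hρ : localNorm (hessian Φ u) (z - u) < 1 / (29 * M) := by
    have h1 := form_le_of_le hu.lower (z - u)
    rw [form_smul_matrix, ← localNorm_sq hQ.posSemidef, ← localNorm_sq hH.posSemidef] at h1
    refine lt_of_pow_lt_pow_left₀ 2 (by positivity) ?_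
    have h2 := pow_le_pow_left₀ (localNorm_nonneg _ _) hz 2
    rw [div_pow, mul_pow] at h2 ⊢
    rw [le_div_iff₀ (by positivity)] at h2
    rw [lt_div_iff₀ (by positivity)]
    have h3 : 0 < M ^ 2 := by positivity
    norm_num at h1
    nlinarith
  have hMρ : M * (1 / (29 * M)) = 1 / 29 := by field_simp
  have hmem := hΦ.mem_interior_of_localNorm_lt hu.mem hρ (by rw [hMρ]; norm_num)
  rw [add_sub_cancel] at hmem
  have hQz := hΦ.hessian_posDef hK hmem
  have hform : ∀ v : E d, v ≠ 0 → form (hessian Φ z) v v ≤ 42 / 37 * form (hessian Φ u) v v ∧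
      37 / 42 * form (hessian Φ u) v v ≤ form (hessian Φ z) v v := by
    intro v hv
    have h := hΦ.abs_log_form_sub_le hK hu.mem hρ (by rw [hMρ]; norm_num) hv
    rw [add_sub_cancel, hMρ] at h
    -- The factor exp(5/42) ≤ 42/37, together with the oracle error 0.001, fits within 1 ± 1/5.
    have hc : 10 / 3 * M * (1 / (29 * M) / (1 - 1 / 29)) = 5 / 42 := by field_simp; norm_num
    rw [hc, abs_le] at h
    have hexp : Real.exp (5 / 42) ≤ 42 / 37 := by
      have h1 := Real.add_one_le_exp (-(5 / 42 : ℝ))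
      rw [Real.exp_neg] at h1
      have h2 : (37 / 42 : ℝ) ≤ (Real.exp (5 / 42))⁻¹ := by linarith
      have h3 := inv_anti₀ (by norm_num) h2
      rw [inv_inv] at h3
      linarith
    have p1 := form_pos hQ hv
    have p2 := form_pos hQz hv
    constructor
    · have : form (hessian Φ z) v v ≤ Real.exp (5 / 42) * form (hessian Φ u) v v := by
        rw [← Real.log_le_log_iff p2 (by positivity), Real.log_mul (by positivity) p1.ne',
          Real.log_exp]
        linarith [h.2]
      nlinarith
    · have : form (hessian Φ u) v v ≤ Real.exp (5 / 42) * form (hessian Φ z) v v := by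
        rw [← Real.log_le_log_iff p1 (by positivity), Real.log_mul (by positivity) p2.ne',
          Real.log_exp]
        linarith [h.1]
      nlinarith
  refine ⟨hmem, le_of_form_le (smul_isHermitian hH.1 _) hQz.1 fun v => ?_,
    le_of_form_le hQz.1 (smul_isHermitian hH.1 _) fun v => ?_⟩ <;>
  · rw [form_smul_matrix]
    by_cases hv : v = 0
    · simp [hv]
    have h1 := form_le_of_le hu.lower v
    have h2 := form_le_of_le hu.upper v
    rw [form_smul_matrix] at h1 h2
    have h3 := hform v hv
    have p1 := form_pos hQ hv
    norm_num at h1 h2 ⊢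
    linarith

/-- The factor 1.1 is a rational upper bound for √1.2. -/
theorem localNorm_hessian_le {A H : Mat d} (hA : A ≤ (1 + 1 / 5 : ℝ) • H) (hH : H.PosSemidef)
    (v : E d) : localNorm A v ≤ 1.1 * localNorm H v := by
  refine localNorm_le_of_le (hA.trans ?_) (by norm_num) v
  rw [Matrix.le_iff, ← sub_smul]
  exact hH.smul (by norm_num)

theorem act_right_inv {A B : Mat d} (h : A * B = 1) (v : E d) : act A (act B v) = v := by
  rw [act_act, h, act_one]

theorem sq_localNorm_act {A B : Mat d} (hA : A.PosSemidef) (h : A * B = 1) (e : E d) :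
    localNorm A (act B e) ^ 2 = inner ℝ e (act B e) := by
  rw [localNorm_sq hA, ← inner_act, act_right_inv h, real_inner_comm]

theorem le_of_sq_le_mul {a c : ℝ} (hc : 0 ≤ c) (h : a ^ 2 ≤ c * a) : a ≤ c := by
  by_contra! hlt
  nlinarith

/-- Changing between dual local norms of comparable matrices. -/
theorem localNorm_act_le {A H G : Mat d} (hA : A.PosDef) (hH : H.PosSemidef) (hG : H * G = 1)
    (hAH : A ≤ (1 + 1 / 5 : ℝ) • H) (e : E d) :
    localNorm H (act G e) ≤ 1.1 * localNorm A⁻¹ e := by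
  refine le_of_sq_le_mul (mul_nonneg (by norm_num) (localNorm_nonneg _ _)) ?_
  rw [sq_localNorm_act hH hG]
  calc inner ℝ e (act G e) ≤ |inner ℝ e (act G e)| := le_abs_self _
    _ ≤ localNorm A⁻¹ e * localNorm A (act G e) := abs_inner_le hA _ _
    _ ≤ localNorm A⁻¹ e * (1.1 * localNorm H (act G e)) :=
        mul_le_mul_of_nonneg_left (localNorm_hessian_le hAH hH _) (localNorm_nonneg _ _)
    _ = _ := by ring

theorem localNorm_ball_convex (hH : H.PosSemidef) {u y z : E d} {r t : ℝ}
    (hy : localNorm H (y - u) ≤ r) (hz : localNorm H (z - u) ≤ r) (ht : t ∈ Set.Icc (0 : ℝ) 1) :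
    localNorm H (y + t • (z - y) - u) ≤ r := by
  have e : y + t • (z - y) - u = (1 - t) • (y - u) + t • (z - u) := by module
  rw [e]
  refine (localNorm_add_le hH _ _).trans ?_
  rw [localNorm_smul, localNorm_smul, abs_of_nonneg ht.1, abs_of_nonneg (sub_nonneg.mpr ht.2)]
  have := sub_nonneg.mpr ht.2
  have := ht.1
  nlinarith

/-- The map `x ↦ x - H⁻¹ ∇Φ(x)` is a contraction near the landmark. -/
theorem IsLandmark.contraction (hu : IsLandmark K Φ u H G) (hΦ : IsSelfConcordant K Φ M)
    (hK : IsCompact K) (hM : 0 < M) {y z : E d} (hy : localNorm H (y - u) ≤ 1 / (30 * M))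
    (hz : localNorm H (z - u) ≤ 1 / (30 * M)) :
    localNorm H (z - y - act G (gradient Φ z - gradient Φ y)) ≤ 1 / 5 * localNorm H (z - y) := by
  have hH := hu.posDef hΦ hK
  have hball : ∀ t ∈ Set.Icc (0 : ℝ) 1, _ := fun t ht =>
    hu.hessian_bounds hΦ hK hM (localNorm_ball_convex hH.posSemidef hy hz ht)
  set v := z - y - act G (gradient Φ z - gradient Φ y) with hv
  refine le_of_sq_le_mul (mul_nonneg (by norm_num) (localNorm_nonneg _ _)) ?_
  -- Testing against `v` makes the problem scalar: the derivative of this function is (H - ∇²Φ)[z -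
  -- y, v], and its increment over [0, 1] is ‖v‖²_H.
  have key := norm_image_sub_le_of_norm_deriv_le_segment_01'
    (f := fun t => t * form H (z - y) v - fderiv ℝ Φ (y + t • (z - y)) v)
    (C := 1 / 5 * localNorm H (z - y) * localNorm H v)
    (fun t ht => (((hasDerivAt_id t).mul_const _).sub (hasDerivAt_fderiv_line
      (hΦ.contDiffAt (hball t ht).1) v)).hasDerivWithinAt)
    (fun t ht => by
      obtain ⟨_, h1, h2⟩ := hball t (Set.Ico_subset_Icc_self ht)
      rw [one_mul, ← form_hessian, Real.norm_eq_abs]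
      exact abs_form_sub_le hH.posSemidef h1 h2 (by norm_num) _ _)
  have e : localNorm H v ^ 2 = form H (z - y) v -
      (fderiv ℝ Φ z v - fderiv ℝ Φ y v) := by
    rw [localNorm_sq hH.posSemidef]
    conv_lhs => rw [form_comm hH.1, ← inner_act, real_inner_comm]
    nth_rewrite 1 [hv]
    rw [act_sub, act_right_inv hu.mul_eq_one, inner_sub_left, inner_sub_left, inner_gradient_left,
      inner_gradient_left, real_inner_comm, inner_act, form_comm hH.1]
  simp only [one_smul, zero_smul, add_zero, add_sub_cancel, one_mul, zero_mul,
    Real.norm_eq_abs] at key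
  rw [e]
  linarith [(abs_le.mp key).2]

end Landmark

/-! ### Values and operation counts of the programs -/

section Programs

variable {d : ℕ}

@[simp] theorem count_tick {α : Type} (o : Op) (a : α) :
    (tick o a).count = Pi.single o 1 := rfl

@[simp] theorem count_mkVec (f : Fin d → Timed ℝ) (o : Op) :
    (mkVec f).count o = ∑ i, (f i).count o := by
  simp [mkVec]

@[simp] theorem count_sumLoop (f : Fin d → Timed ℝ) (o : Op) :
    (sumLoop f).count o = ∑ i, ((f i).count o + (Pi.single Op.arith 1 : Op → ℕ) o) := by
  simp [sumLoop]

/-- One approximate Newton step. -/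
def newtonStep (O : Oracles d) (G : Mat d) (s y : E d) : E d := y - act G (O.grad y + s)

@[simp] theorem val_newtonLoop_succ (O : Oracles d) (G : Mat d) (s y : E d) (k : ℕ) :
    (newtonLoop O G s (k + 1) y).val = (newtonLoop O G s k (newtonStep O G s y)).val := rfl

theorem count_newtonLoop_hessCall (O : Oracles d) (G : Mat d) (s y : E d) (k : ℕ) :
    (newtonLoop O G s k y).count Op.hessCall = 0 := by
  induction k generalizing y with
  | zero => rfl
  | succ k ih => simp [newtonLoop, ih, callGrad, vecAdd, vecSub, matVec, add, sub, mul]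

theorem count_newtonLoop_gradCall (O : Oracles d) (G : Mat d) (s y : E d) (k : ℕ) :
    (newtonLoop O G s k y).count Op.gradCall = k := by
  induction k generalizing y with
  | zero => rfl
  | succ k ih =>
    simp [newtonLoop, ih, callGrad, vecAdd, vecSub, matVec, add, sub, mul]
    ring

theorem count_newtonLoop_arith (O : Oracles d) (G : Mat d) (s y : E d) (k : ℕ) :
    (newtonLoop O G s k y).count Op.arith = k * (2 * d + 2 * d ^ 2) := by
  induction k generalizing y with
  | zero => simp [newtonLoop]
  | succ k ih =>
    simp [newtonLoop, ih, callGrad, vecAdd, vecSub, matVec, add, sub, mul]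
    ring

variable (O : Oracles d) (η M : ℝ) (m : ℕ) (S : State d) (g : E d)

/-- The iterate reached at the end of a round. -/
def nextIterate : E d := (newtonLoop O S.Hinv (S.s + η • g) (m - 1) S.w).val

/-- The update of the landmark at the end of a round. -/
def updateLandmark (s w : E d) (close : Bool) : Timed (State d) :=
  if close then
    pure { w := w, u := S.u, s := s, H := S.H, Hinv := S.Hinv }
  else do
    let HH ← callHess O w
    pure { w := w, u := w, s := s, H := HH.1, Hinv := HH.2 }

theorem count_updateLandmark (s w : E d) (close : Bool) :
    (updateLandmark O S s w close).count = if close then 0 else Pi.single Op.hessCall 1 := by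
  cases close <;> simp [updateLandmark, callHess]

theorem val_playRound : (playRound O η M m S g).val =
    (updateLandmark O S (S.s + η • g) (nextIterate O η m S g)
      (decide (localNorm S.H (nextIterate O η m S g - S.u) ≤ 1 / (41 * M)))).val := rfl

theorem count_playRound (o : Op) : (playRound O η M m S g).count o =
    (2 * d ^ 2 + 5 * d + 4) * (Pi.single Op.arith 1 : Op → ℕ) o +
    (newtonLoop O S.Hinv (S.s + η • g) (m - 1) S.w).count o +
    if localNorm S.H (nextIterate O η m S g - S.u) ≤ 1 / (41 * M) then 0
      else (Pi.single Op.hessCall 1 : Op → ℕ) o := by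
  have h : (playRound O η M m S g).count o = (vecScale η g).count o +
    ((vecAdd S.s (η • g)).count o + ((newtonLoop O S.Hinv (S.s + η • g) (m - 1) S.w).count o +
    ((vecSub (nextIterate O η m S g) S.u).count o +
    (((matVec S.H (nextIterate O η m S g - S.u)).count o +
      ((dot (nextIterate O η m S g - S.u) (act S.H (nextIterate O η m S g - S.u))).count o +
        (Pi.single Op.arith 1 : Op → ℕ) o)) +
    ((Pi.single Op.arith 1 : Op → ℕ) o + ((Pi.single Op.arith 1 : Op → ℕ) o +
    ((Pi.single Op.arith 1 : Op → ℕ) o + (updateLandmark O S (S.s + η • g) (nextIterate O η m S g)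
      (decide (localNorm S.H (nextIterate O η m S g - S.u) ≤ 1 / (41 * M)))).count o))))))) := rfl
  rw [h, count_updateLandmark]
  by_cases hle : localNorm S.H (nextIterate O η m S g - S.u) ≤ 1 / (41 * M)
  all_goals
    simp only [hle, decide_true, decide_false, if_true, if_false, Pi.zero_apply, vecScale, vecAdd,
      vecSub, matVec, dot, count_mkVec, count_sumLoop, mul, add, sub, count_tick, Finset.sum_const,
      Finset.card_univ, Fintype.card_fin, smul_eq_mul, Bool.false_eq_true]
    ring

theorem playRound_of_le (h : localNorm S.H (nextIterate O η m S g - S.u) ≤ 1 / (41 * M)) :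
    (playRound O η M m S g).val =
      { w := nextIterate O η m S g, u := S.u, s := S.s + η • g, H := S.H, Hinv := S.Hinv } ∧
    (playRound O η M m S g).count Op.hessCall = 0 := by
  constructor
  · rw [val_playRound, decide_eq_true h]
    rfl
  · rw [count_playRound, if_pos h]
    simp [count_newtonLoop_hessCall]

theorem playRound_of_lt (h : 1 / (41 * M) < localNorm S.H (nextIterate O η m S g - S.u)) :
    (playRound O η M m S g).val =
      { w := nextIterate O η m S g, u := nextIterate O η m S g, s := S.s + η • g,
        H := (O.hess (nextIterate O η m S g)).1, Hinv := (O.hess (nextIterate O η m S g)).2 } ∧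
    (playRound O η M m S g).count Op.hessCall = 1 := by
  constructor
  · rw [val_playRound, decide_eq_false h.not_ge]
    rfl
  · rw [count_playRound, if_neg h.not_ge]
    simp [count_newtonLoop_hessCall]

theorem count_playRound_gradCall : (playRound O η M m S g).count Op.gradCall = m - 1 := by
  simp [count_playRound, count_newtonLoop_gradCall]

theorem count_playRound_arith : (playRound O η M m S g).count Op.arith =
    (m - 1) * (2 * d + 2 * d ^ 2) + 2 * d ^ 2 + 5 * d + 4 := by
  simp [count_playRound, count_newtonLoop_arith]
  ring

variable (w₀ : E d) (γ : ℕ → E d) (t : ℕ)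

theorem state_zero : state O η M m w₀ γ 0 =
    { w := w₀, u := w₀, s := 0, H := (O.hess w₀).1, Hinv := (O.hess w₀).2 } := rfl

theorem state_succ : state O η M m w₀ γ (t + 1) =
    (playRound O η M m (state O η M m w₀ γ t) (γ t)).val := rfl

theorem count_run_succ (o : Op) : (run O η M m w₀ γ (t + 1)).count o =
    (run O η M m w₀ γ t).count o + (playRound O η M m (state O η M m w₀ γ t) (γ t)).count o := rfl

theorem count_run_zero_hessCall : (run O η M m w₀ γ 0).count Op.hessCall = 1 := by
  simp [run, start, callHess]

theorem count_run_gradCall : (run O η M m w₀ γ t).count Op.gradCall = t * (m - 1) := by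
  induction t with
  | zero => simp [run, start, callHess]
  | succ t ih => rw [count_run_succ, ih, count_playRound_gradCall]; ring

theorem count_run_arith : (run O η M m w₀ γ t).count Op.arith =
    t * ((m - 1) * (2 * d + 2 * d ^ 2) + 2 * d ^ 2 + 5 * d + 4) := by
  induction t with
  | zero => simp [run, start, callHess]
  | succ t ih => rw [count_run_succ, ih, count_playRound_arith]; ring

end Programs

/-! ### One round of BARONS -/

section Round

variable {d : ℕ} {K : Set (E d)} {Φ : E d → ℝ} {M : ℝ} {u : E d} {H G : Mat d}

theorem continuous_act (A : Mat d) : Continuous (act A) := by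
  unfold act
  fun_prop

theorem continuous_localNorm (A : Mat d) : Continuous (localNorm A) := by
  unfold localNorm
  fun_prop

theorem IsSelfConcordant.continuousAt_gradient (hΦ : IsSelfConcordant K Φ M) {x : E d}
    (hx : x ∈ interior K) : ContinuousAt (gradient Φ) x :=
  (InnerProductSpace.toDual ℝ (E d)).symm.continuous.continuousAt.comp
    (hasFDerivAt_fderiv (hΦ.contDiffAt hx)).continuousAt

theorem eq_zero_of_localNorm_eq_zero {A : Mat d} (hA : A.PosDef) {v : E d}
    (h : localNorm A v = 0) : v = 0 := by
  by_contra hv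
  exact (Real.sqrt_pos.mpr (form_pos hA hv)).ne' h

/-- The gradient attains every value close to its value at a point near the landmark. -/
theorem IsLandmark.exists_gradient_eq (hu : IsLandmark K Φ u H G) (hΦ : IsSelfConcordant K Φ M)
    (hK : IsCompact K) (hM : 0 < M) {y s : E d} {r : ℝ}
    (hr : 5 / 4 * localNorm H (act G (gradient Φ y + s)) ≤ r)
    (hball : localNorm H (y - u) + r ≤ 1 / (30 * M)) :
    ∃ z, localNorm H (z - y) ≤ r ∧ gradient Φ z = -s := by
  have hH := hu.posDef hΦ hK
  have hr0 : 0 ≤ r := (mul_nonneg (by norm_num) (localNorm_nonneg _ _)).trans hr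
  set B : Set (E d) := {x | localNorm H (x - y) ≤ r} with hB
  have hB30 : ∀ x ∈ B, localNorm H (x - u) ≤ 1 / (30 * M) := fun x hx =>
    (localNorm_sub_le hH.posSemidef x y u).trans (by linarith [show localNorm H (x - y) ≤ r from hx])
  have hyB : y ∈ B := by simpa [hB, localNorm_zero] using hr0
  have hBK : ∀ x ∈ B, x ∈ interior K := fun x hx => (hu.hessian_bounds hΦ hK hM (hB30 x hx)).1
  have hBcl : IsClosed B :=
    isClosed_le ((continuous_localNorm H).comp (continuous_id.sub continuous_const))
      continuous_const
  have hBc : IsCompact B := hK.of_isClosed_subset hBcl fun x hx => interior_subset (hBK x hx)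
  have hcont : ContinuousOn (fun x => localNorm H (act G (gradient Φ x + s))) B := fun x hx =>
    (((continuous_localNorm H).comp (continuous_act G)).continuousAt.comp
      ((hΦ.continuousAt_gradient (hBK x hx)).add continuousAt_const)).continuousWithinAt
  -- A minimizer of the Newton residual replaces the fixed point iteration. One exact step from it
  -- stays in `B`, as r/5 + 4r/5 = r, and shrinks the residual by 1/5, so the minimal residual is 0.
  obtain ⟨x, hx, hmin⟩ := hBc.exists_isMinOn ⟨y, hyB⟩ hcont
  set x' := x - act G (gradient Φ x + s) with hx'
  have hx'B : x' ∈ B := by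
    have h1 := hu.contraction hΦ hK hM (hB30 y hyB) (hB30 x hx)
    have h2 := localNorm_sub_le hH.posSemidef
      (x - y - act G (gradient Φ x - gradient Φ y)) 0 (act G (gradient Φ y + s))
    have e : x - y - act G (gradient Φ x - gradient Φ y) - act G (gradient Φ y + s) = x' - y := by
      rw [hx']
      simp only [act_add, act_sub]
      abel
    rw [e, sub_zero, zero_sub, localNorm_neg] at h2
    have h3 : localNorm H (x - y) ≤ r := hx
    show localNorm H (x' - y) ≤ r
    linarith
  have hle := hmin hx'B
  simp only [Set.mem_ofPred_eq] at hle
  have h1 := hu.contraction hΦ hK hM (hB30 x hx) (hB30 x' hx'B)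
  have e1 : x' - x = -act G (gradient Φ x + s) := by rw [hx']; abel
  have e2 : x' - x - act G (gradient Φ x' - gradient Φ x) = -act G (gradient Φ x' + s) := by
    rw [e1]
    simp only [act_add, act_sub]
    abel
  rw [e2, e1, localNorm_neg, localNorm_neg] at h1
  have h0 : localNorm H (act G (gradient Φ x + s)) = 0 :=
    le_antisymm (by linarith) (localNorm_nonneg _ _)
  refine ⟨x, hx, eq_neg_of_add_eq_zero_left ?_⟩
  rw [← act_right_inv hu.mul_eq_one (gradient Φ x + s), eq_zero_of_localNorm_eq_zero hH h0]
  simp [act]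

variable {O : Oracles d} {ε : ℝ}

theorem IsLandmark.newtonStep_le (hu : IsLandmark K Φ u H G) (hΦ : IsSelfConcordant K Φ M)
    (hK : IsCompact K) (hM : 0 < M) (hO : IsGradOracle K Φ ε O.grad) {s y z : E d}
    (hy : localNorm H (y - u) ≤ 1 / (30 * M)) (hz : localNorm H (z - u) ≤ 1 / (30 * M))
    (hzs : gradient Φ z = -s) :
    localNorm H (newtonStep O G s y - z) ≤ 1 / 5 * localNorm H (y - z) + 1.1 * ε := by
  have hH := hu.posDef hΦ hK
  have h1 := hu.contraction hΦ hK hM hz hy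
  obtain ⟨hyK, _, hyH⟩ := hu.hessian_bounds hΦ hK hM hy
  have h2 := localNorm_act_le (hΦ.hessian_posDef hK hyK) hH.posSemidef hu.mul_eq_one hyH
    (O.grad y - gradient Φ y)
  have h3 : localNorm (hessian Φ y)⁻¹ (O.grad y - gradient Φ y) ≤ ε := hO y hyK
  have h4 := localNorm_sub_le hH.posSemidef (y - z - act G (gradient Φ y - gradient Φ z)) 0
    (act G (O.grad y - gradient Φ y))
  have e : y - z - act G (gradient Φ y - gradient Φ z) - act G (O.grad y - gradient Φ y) =
      newtonStep O G s y - z := by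
    rw [newtonStep, show O.grad y + s = (gradient Φ y - gradient Φ z) + (O.grad y - gradient Φ y)
      by rw [hzs]; abel, act_add]
    abel
  rw [e, sub_zero, zero_sub, localNorm_neg] at h4
  linarith

/-- Iterates e ↦ e/5 + 1.1ε, whose fixed point is 1.375ε. The condition 1.375ε ≤ R keeps every
iterate within `R` of `z`, where the contraction is valid. -/
theorem IsLandmark.newtonLoop_le (hu : IsLandmark K Φ u H G) (hΦ : IsSelfConcordant K Φ M)
    (hK : IsCompact K) (hM : 0 < M) (hO : IsGradOracle K Φ ε O.grad) {s z : E d} {R : ℝ}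
    (hz : localNorm H (z - u) + R ≤ 1 / (30 * M)) (hR : 1.375 * ε ≤ R) (hε : 0 ≤ ε)
    (hzs : gradient Φ z = -s) (k : ℕ) {y : E d} (hy : localNorm H (y - z) ≤ R) :
    localNorm H ((newtonLoop O G s k y).val - z) ≤
      (1 / 5) ^ k * localNorm H (y - z) + 1.375 * (1 - (1 / 5) ^ k) * ε := by
  have hH := hu.posDef hΦ hK
  induction k generalizing y with
  | zero => simp [newtonLoop]
  | succ k ih =>
    have hyu := localNorm_sub_le hH.posSemidef y z u
    have hstep := hu.newtonStep_le hΦ hK hM hO (by linarith) (by linarith) hzs (y := y)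
    have h1 := ih (y := newtonStep O G s y) (by linarith)
    rw [val_newtonLoop_succ]
    have h2 := mul_le_mul_of_nonneg_left hstep (by positivity : (0 : ℝ) ≤ (1 / 5) ^ k)
    rw [pow_succ]
    linarith

/-- The invariant maintained by BARONS: `z` is the exact minimizer approximated by the iterate. -/
structure Invariant (K : Set (E d)) (Φ : E d → ℝ) (M ε : ℝ) (S : State d) (z : E d) : Prop where
  landmark : IsLandmark K Φ S.u S.H S.Hinv
  close : localNorm S.H (S.w - S.u) ≤ 1 / (41 * M)
  accurate : localNorm S.H (S.w - z) ≤ 4 * ε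
  gradient_eq : gradient Φ z = -S.s

variable {S : State d} {z g : E d} {η b : ℝ} {m : ℕ}

theorem Invariant.ball (hS : Invariant K Φ M ε S z) (hM : 0 < M) :
    localNorm S.H (S.w - S.u) ≤ 1 / (30 * M) :=
  hS.close.trans (by gcongr; norm_num)

theorem Invariant.ball_minimizer (hS : Invariant K Φ M ε S z) (hΦ : IsSelfConcordant K Φ M)
    (hK : IsCompact K) (hM : 0 < M) (hε : ε ≤ 1 / (20000 * M)) :
    localNorm S.H (z - S.u) ≤ 1 / 40 * (1 / M) := by
  have h1 := localNorm_sub_le (hS.landmark.posDef hΦ hK).posSemidef z S.w S.u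
  rw [localNorm_sub_comm _ z S.w] at h1
  have h2 := hS.close
  have h3 := hS.accurate
  rw [← one_div_mul_one_div] at h2 hε
  have : 0 < 1 / M := by positivity
  linarith

theorem Invariant.playRound (hS : Invariant K Φ M ε S z) (hΦ : IsSelfConcordant K Φ M)
    (hK : IsCompact K) (hM : 0 < M) (hη : 0 < η) (hε : 0 < ε) (hb : η * b ≤ 1 / (1000 * M))
    (hεM : ε ≤ 1 / (20000 * M)) (hm : (1 / 5 : ℝ) ^ (m - 1) ≤ ε * M)
    (hO : IsGradOracle K Φ ε O.grad) (hO' : IsHessOracle K Φ 0.001 O.hess)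
    (hg : dualLocalNorm Φ S.w g ≤ b) :
    ∃ z', Invariant K Φ M ε (playRound O η M m S g).val z' ∧
      localNorm S.H (S.w - z') ≤ 4 * ε + 1.375 * (η * dualLocalNorm Φ S.w g) ∧
      (∀ k, (newtonLoop O S.Hinv (S.s + η • g) k S.w).val ∈ interior K) ∧
      ((BARONS.playRound O η M m S g).count Op.hessCall : ℝ) +
          41 * M * localNorm (BARONS.playRound O η M m S g).val.H
            ((BARONS.playRound O η M m S g).val.w - (BARONS.playRound O η M m S g).val.u) ≤
        41 * M * localNorm S.H (S.w - S.u) +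
          41 * M * (7 * ε + 1.375 * (η * dualLocalNorm Φ S.w g)) := by
  have hu := hS.landmark
  have hH := hu.posDef hΦ hK
  set a := dualLocalNorm Φ S.w g with ha
  have ha0 : 0 ≤ a := localNorm_nonneg _ _
  have hab : η * a ≤ 1 / (1000 * M) := (mul_le_mul_of_nonneg_left hg hη.le).trans hb
  have hM' : 0 < 1 / M := by positivity
  have hzu := hS.ball_minimizer hΦ hK hM hεM
  obtain ⟨hwK, _, hwH⟩ := hu.hessian_bounds hΦ hK hM (hS.ball hM)
  have hGg : localNorm S.H (act S.Hinv (η • g)) ≤ 1.1 * (η * a) := by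
    refine (localNorm_act_le (hΦ.hessian_posDef hK hwK) hH.posSemidef hu.mul_eq_one hwH _).trans ?_
    rw [localNorm_smul, abs_of_pos hη]
    rfl
  have e1 : 1 / (30 * M) = 1 / 30 * (1 / M) := by field_simp
  have e2 : 1 / (1000 * M) = 1 / 1000 * (1 / M) := by field_simp
  have e3 : 1 / (20000 * M) = 1 / 20000 * (1 / M) := by field_simp
  have e4 : 1 / (41 * M) = 1 / 41 * (1 / M) := by field_simp
  rw [e2] at hab
  rw [e3] at hεM
  -- At the old leader the new residual is just H⁻¹(ηg), of norm at most 1.1ηa; the radius is 5/4 of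
  -- that.
  obtain ⟨z', hz', hgz'⟩ := hu.exists_gradient_eq hΦ hK hM (y := z) (s := S.s + η • g)
    (r := 1.375 * (η * a)) (by rw [hS.gradient_eq, neg_add_cancel_left]; linarith)
    (by rw [e1]; linarith)
  have hz'u := localNorm_sub_le hH.posSemidef z' z S.u
  have hwz' : localNorm S.H (S.w - z') ≤ 4 * ε + 1.375 * (η * a) := by
    have := localNorm_sub_le hH.posSemidef S.w z z'
    rw [localNorm_sub_comm _ z z'] at this
    linarith [hS.accurate]
  -- The radius 1/(500M) exceeds 4/20000 + 1.375/1000 in units of 1/M, and together with the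
  -- distance of `z'` from the landmark it stays below 1/(30M).
  have hloop := fun k => hu.newtonLoop_le hΦ hK hM hO (z := z') (s := S.s + η • g)
    (R := 1 / 500 * (1 / M)) (by rw [e1]; linarith) (by linarith) hε.le hgz' k (y := S.w)
    (by linarith)
  have hmem : ∀ k, localNorm S.H ((newtonLoop O S.Hinv (S.s + η • g) k S.w).val - S.u) ≤
      1 / (30 * M) := by
    intro k
    have h1 := hloop k
    have h2 : (1 / 5 : ℝ) ^ k ≤ 1 := pow_le_one₀ (by norm_num) (by norm_num)
    have h3 : (0 : ℝ) ≤ (1 / 5) ^ k := by positivity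
    have h4 := localNorm_sub_le hH.posSemidef
      (newtonLoop O S.Hinv (S.s + η • g) k S.w).val z' S.u
    have h5 := mul_le_of_le_one_left (localNorm_nonneg S.H (S.w - z')) h2
    have h6 := mul_nonneg h3 hε.le
    rw [e1]
    linarith
  -- The bound 3ε leaves room below 4ε for a change of norm: a new `H` costs at most a factor 1.1,
  -- as 1.001 · 1.2 ≤ 1.21.
  have hnext : localNorm S.H (nextIterate O η m S g - z') ≤ 3 * ε := by
    have h1 := hloop (m - 1)
    have h3 : (0 : ℝ) ≤ (1 / 5) ^ (m - 1) := by positivity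
    have h4 : (1 / 5 : ℝ) ^ (m - 1) * localNorm S.H (S.w - z') ≤ ε * M * (1 / 500 * (1 / M)) :=
      mul_le_mul hm (by linarith) (localNorm_nonneg _ _) (by positivity)
    have h5 : ε * M * (1 / 500 * (1 / M)) = 1 / 500 * ε := by field_simp
    have h6 := mul_nonneg h3 hε.le
    unfold nextIterate
    linarith
  have hmove : localNorm S.H (nextIterate O η m S g - S.w) ≤ 7 * ε + 1.375 * (η * a) := by
    have := localNorm_sub_le hH.posSemidef (nextIterate O η m S g) z' S.w
    rw [localNorm_sub_comm _ z'] at this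
    linarith
  have hdist := localNorm_sub_le hH.posSemidef (nextIterate O η m S g) S.w S.u
  have hM41 : 0 < 41 * M := by positivity
  have hpot := mul_le_mul_of_nonneg_left (hdist.trans (add_le_add_left hmove _)) hM41.le
  refine ⟨z', ?_, hwz', fun k => (hu.hessian_bounds hΦ hK hM (hmem k)).1, ?_⟩
  · rcases le_or_gt (localNorm S.H (nextIterate O η m S g - S.u)) (1 / (41 * M)) with h | h
    · rw [(playRound_of_le O η M m S g h).1]
      exact ⟨hu, h, by linarith, hgz'⟩
    · rw [(playRound_of_lt O η M m S g h).1]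
      obtain ⟨hK', _, hH'⟩ := hu.hessian_bounds hΦ hK hM (hmem (m - 1))
      have hl := hO'.isLandmark (show nextIterate O η m S g ∈ interior K from hK')
      refine ⟨hl, by simpa [localNorm_zero] using hM.le, ?_, hgz'⟩
      have hle : localNorm (O.hess (nextIterate O η m S g)).1 (nextIterate O η m S g - z') ≤
          1.1 * localNorm S.H (nextIterate O η m S g - z') := by
        refine localNorm_le_of_le (le_of_form_le (hl.posDef hΦ hK).1
          (smul_isHermitian hH.1 _) fun v => ?_) (by norm_num) _
        have f1 := form_le_of_le hl.upper v
        have f2 := form_le_of_le hH' v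
        have f3 := form_nonneg hH.posSemidef v
        rw [form_smul_matrix] at f1 f2 ⊢
        change _ ≤ _ * form (hessian Φ (nextIterate O η m S g)) v v at f1
        change form (hessian Φ (nextIterate O η m S g)) v v ≤ _ at f2
        norm_num at f1 f2 ⊢
        linarith
      show localNorm (O.hess (nextIterate O η m S g)).1 (nextIterate O η m S g - z') ≤ 4 * ε
      linarith
  · rcases le_or_gt (localNorm S.H (nextIterate O η m S g - S.u)) (1 / (41 * M)) with h | h
    · rw [(playRound_of_le O η M m S g h).1, (playRound_of_le O η M m S g h).2]
      simp only [Nat.cast_zero, zero_add]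
      linarith
    -- The new distance is 0, and the single call is charged to the old potential, which exceeded 1.
    · rw [(playRound_of_lt O η M m S g h).1, (playRound_of_lt O η M m S g h).2]
      simp only [Nat.cast_one, sub_self, localNorm_zero]
      rw [div_lt_iff₀ hM41] at h
      linarith

end Round

/-! ### The run of BARONS -/

section Run

variable {d : ℕ} {K : Set (E d)} {Φ : E d → ℝ} {M : ℝ}

theorem Invariant.minimizer_mem {ε : ℝ} {S : State d} {z : E d} (hS : Invariant K Φ M ε S z)
    (hΦ : IsSelfConcordant K Φ M) (hK : IsCompact K) (hM : 0 < M) (hε : ε ≤ 1 / (20000 * M)) :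
    z ∈ interior K := by
  refine (hS.landmark.hessian_bounds hΦ hK hM ((hS.ball_minimizer hΦ hK hM hε).trans ?_)).1
  have : 0 < 1 / M := by positivity
  rw [← one_div_mul_one_div]
  linarith

/-- The regret of the sequence of minimizers that look one step ahead. -/
theorem IsSelfConcordant.sum_inner_le (hΦ : IsSelfConcordant K Φ M) {y s : ℕ → E d} {T : ℕ}
    (hy : ∀ t ≤ T, y t ∈ interior K) (hys : ∀ t ≤ T, gradient Φ (y t) = -s t) (hs : s 0 = 0)
    {w : E d} (hw : w ∈ interior K) :
    ∑ t ∈ Finset.range T, inner ℝ (s (t + 1) - s t) (y (t + 1) - w) ≤ Φ w - Φ (y 0) := by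
  have opt : ∀ t ≤ T, ∀ v ∈ interior K,
      Φ (y t) + inner ℝ (s t) (y t) ≤ Φ v + inner ℝ (s t) v := by
    intro t ht v hv
    have := hΦ.add_fderiv_le (hy t ht) hv
    rw [← inner_gradient_left, hys t ht, inner_neg_left, inner_sub_right] at this
    linarith
  -- Be-the-leader: in the inductive step, the optimality of `y n` is compared with the point `y (n
  -- + 1)`.
  have lead : ∀ n ≤ T, Φ (y 0) + ∑ t ∈ Finset.range n, inner ℝ (s (t + 1) - s t) (y (t + 1)) ≤
      Φ (y n) + inner ℝ (s n) (y n) := by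
    intro n
    induction n with
    | zero => simp [hs]
    | succ n ih =>
      intro hn
      rw [Finset.sum_range_succ, inner_sub_left]
      linarith [ih (by omega), opt n (by omega) _ (hy (n + 1) hn)]
  have tele : ∑ t ∈ Finset.range T, inner ℝ (s (t + 1) - s t) w = inner ℝ (s T) w := by
    rw [← sum_inner, Finset.sum_range_sub, hs, sub_zero]
  simp only [inner_sub_right, Finset.sum_sub_distrib, tele]
  linarith [lead T le_rfl, opt T le_rfl w hw]

theorem state_succ_s (O : Oracles d) (η : ℝ) (m : ℕ) (w₀ : E d) (g : ℕ → E d) (t : ℕ) :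
    (state O η M m w₀ g (t + 1)).s = (state O η M m w₀ g t).s + η • g t := by
  rw [state_succ, val_playRound]
  unfold updateLandmark
  split <;> rfl

theorem one_le_log {x : ℝ} (hx : 0 < x) (h : x ≤ 1 / 20000) : 1 ≤ Real.log (1 / x) := by
  rw [Real.le_log_iff_exp_le (by positivity), le_div_iff₀ hx]
  have := Real.exp_one_lt_d9
  nlinarith

/-- Since 1/5 ≤ 1/e, it suffices that m - 1 ≥ log(1/x). The factor 2 absorbs the lost step because
the logarithm is at least 1. -/
theorem pow_le_of_log_le {x : ℝ} (hx : 0 < x) (h : x ≤ 1 / 20000) {m : ℕ}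
    (hm : 2 * Real.log (1 / x) ≤ m) : (1 / 5 : ℝ) ^ (m - 1) ≤ x := by
  have h1 := one_le_log hx h
  have hm1 : 1 ≤ m := by
    have : (1 : ℝ) ≤ m := by linarith
    exact_mod_cast this
  have h5 : (1 / 5 : ℝ) ≤ Real.exp (-1) := by
    rw [Real.exp_neg, one_div]
    have := Real.exp_one_lt_d9
    exact inv_anti₀ (Real.exp_pos _) (by linarith)
  calc (1 / 5 : ℝ) ^ (m - 1) ≤ Real.exp (-1) ^ (m - 1) := by gcongr
    _ = Real.exp (-((m : ℝ) - 1)) := by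
      rw [← Real.exp_nat_mul, Nat.cast_sub hm1]
      congr 1
      push_cast
      ring
    _ ≤ Real.exp (-Real.log (1 / x)) := by
      gcongr
      linarith
    _ = x := by
      rw [one_div, Real.log_inv, neg_neg, Real.exp_log hx]

/-- The number of elementary operations in a round, in terms of the number of Newton steps. -/
theorem round_arith_le {d m : ℕ} (hd : 0 < d) {c L : ℝ} (hL : 1 ≤ L) (hm : (m : ℝ) ≤ c * L) :
    (((m - 1) * (2 * d + 2 * d ^ 2) + 2 * d ^ 2 + 5 * d + 4 : ℕ) : ℝ) ≤
      (4 * c + 11) * ((d : ℝ) ^ 2 * L) := by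
  have h1 : (m - 1) * (2 * d + 2 * d ^ 2) + 2 * d ^ 2 + 5 * d + 4 ≤ (4 * m + 11) * d ^ 2 := by
    have h2 : d ≤ d ^ 2 := Nat.le_self_pow two_ne_zero d
    have h3 : (m - 1) * (2 * d + 2 * d ^ 2) ≤ m * (4 * d ^ 2) :=
      Nat.mul_le_mul (Nat.sub_le _ _) (by omega)
    nlinarith
  calc _ ≤ (((4 * m + 11) * d ^ 2 : ℕ) : ℝ) := by exact_mod_cast h1
    _ = (4 * (m : ℝ) + 11) * (d : ℝ) ^ 2 := by push_cast; ring
    _ ≤ (4 * (c * L) + 11 * L) * (d : ℝ) ^ 2 := by gcongr; linarith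
    _ = _ := by ring

end Run

end BARONS

/-! ### The master theorem: regret, Hessian calls and total cost -/

theorem theorem1 :
    ∃ c₁ : ℝ, 0 < c₁ ∧ ∃ C : ℝ, 0 < C ∧ ∀ c₂ : ℝ, c₁ ≤ c₂ → ∃ C' : ℝ, 0 < C' ∧
      ∀ (d : ℕ), 0 < d →
      ∀ (K : Set (BARONS.E d)), IsCompact K → Convex ℝ K → (interior K).Nonempty →
      ∀ (Φ : BARONS.E d → ℝ) (M : ℝ), 0 < M → BARONS.IsSelfConcordant K Φ M →
      ∀ (b η ε : ℝ), 0 < b → 0 < η → 0 < ε →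
        η ≤ 1 / (1000 * b * M) → ε ≤ 1 / (20000 * M) →
      ∀ (mNewton : ℕ),
        c₁ * Real.log (1 / (ε * M)) ≤ mNewton → mNewton ≤ c₂ * Real.log (1 / (ε * M)) →
      ∀ (O : BARONS.Oracles d),
        BARONS.IsGradOracle K Φ ε O.grad → BARONS.IsHessOracle K Φ 0.001 O.hess →
      ∀ (wstar : BARONS.E d), wstar ∈ interior K → IsMinOn Φ (interior K) wstar →
      ∀ (T : ℕ) (l : ℕ → BARONS.E d → ℝ) (g : ℕ → BARONS.E d),
        (∀ t < T, ConvexOn ℝ K (l t)) →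
        (∀ t < T, BARONS.IsSubgradient K (l t)
          (BARONS.iterate O η M mNewton wstar g t) (g t)) →
        (∀ t < T, BARONS.dualLocalNorm Φ (BARONS.iterate O η M mNewton wstar g t) (g t) ≤ b) →
        -- all points that are played or at which an oracle is called lie in the interior of `K`
        (∀ t ≤ T, BARONS.iterate O η M mNewton wstar g t ∈ interior K) ∧
        (∀ t < T, ∀ k < mNewton,
          (BARONS.newtonLoop O (BARONS.state O η M mNewton wstar g t).Hinv
            (BARONS.state O η M mNewton wstar g (t + 1)).s k
            (BARONS.iterate O η M mNewton wstar g t)).val ∈ interior K) ∧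
        -- regret
        (∀ w ∈ interior K,
          ∑ t ∈ Finset.range T, (l t (BARONS.iterate O η M mNewton wstar g t) - l t w) ≤
            C * ((Φ w - Φ wstar) / η
              + η * ∑ t ∈ Finset.range T,
                  BARONS.dualLocalNorm Φ (BARONS.iterate O η M mNewton wstar g t) (g t) ^ 2
              + ε * ∑ t ∈ Finset.range T,
                  BARONS.dualLocalNorm Φ (BARONS.iterate O η M mNewton wstar g t) (g t))) ∧
        -- number of Hessian computations: the initial one and the recomputations
        ((BARONS.run O η M mNewton wstar g T).count BARONS.Op.hessCall : ℝ) ≤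
          1 + C * (M * T * ε + M * ∑ t ∈ Finset.range T,
            η * BARONS.dualLocalNorm Φ (BARONS.iterate O η M mNewton wstar g t) (g t)) ∧
        -- total computational cost
        (∀ Cgrad Chess : ℝ, 0 ≤ Cgrad → 0 ≤ Chess →
          (BARONS.run O η M mNewton wstar g T).totalCost Cgrad Chess ≤
            Chess + C' * ((Cgrad + (d : ℝ) ^ 2) * T * Real.log (1 / (ε * M))
              + Chess * (M * T * ε + M * ∑ t ∈ Finset.range T,
                  η * BARONS.dualLocalNorm Φ
                    (BARONS.iterate O η M mNewton wstar g t) (g t)))) := by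
  open BARONS in
  -- The constant 400 covers 41 · 7 = 287 from the potential. In 4c₂ + 411, the part 4c₂ + 11 pays
  -- for the arithmetic of a round and 400 for the Hessian calls.
  refine ⟨2, two_pos, 400, by norm_num, fun c₂ hc₂ => ⟨4 * c₂ + 411, by linarith, ?_⟩⟩
  intro d hd K hK _ _ Φ M hM hΦ b η ε hb hη hε hηb hεM m hm₁ hm₂ O hO hO' wstar hwK hwmin T l g _
    hsub hgb
  have hεM' : ε * M ≤ 1 / 20000 := by
    rw [le_div_iff₀ (by positivity)] at hεM ⊢
    linarith
  have hηb' : η * b ≤ 1 / (1000 * M) := by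
    rw [le_div_iff₀ (by positivity)] at hηb ⊢
    linarith
  have hpow := pow_le_of_log_le (by positivity) hεM' hm₁
  have hL := one_le_log (by positivity) hεM'
  set L := Real.log (1 / (ε * M))
  set S := state O η M m wstar g with hSdef
  set a : ℕ → ℝ := fun t => dualLocalNorm Φ (iterate O η M m wstar g t) (g t) with hadef
  have ha0 : ∀ t, 0 ≤ a t := fun t => localNorm_nonneg _ _
  have hinit : Invariant K Φ M ε (S 0) wstar := by
    refine ⟨hO'.isLandmark hwK, ?_, ?_, ?_⟩
    · rw [hSdef, state_zero, sub_self, localNorm_zero]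
      positivity
    · rw [hSdef, state_zero, sub_self, localNorm_zero]
      positivity
    · have h0 := (hwmin.isLocalMin (isOpen_interior.mem_nhds hwK)).fderiv_eq_zero
      simp [gradient, h0, hSdef, state_zero]
  have hround : ∀ t < T, ∀ z, Invariant K Φ M ε (S t) z → _ := fun t ht z hz =>
    hz.playRound hΦ hK hM hη hε hηb' hεM hpow hO hO' (g := g t) (hgb t ht)
  have hinv : ∀ t ≤ T, ∃ z, Invariant K Φ M ε (S t) z := by
    intro t
    induction t with
    | zero => exact fun _ => ⟨wstar, hinit⟩
    | succ t ih =>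
      intro ht
      obtain ⟨z, hz⟩ := ih (by omega)
      obtain ⟨z', hz', _⟩ := hround t ht z hz
      exact ⟨z', hz'⟩
  -- The guard inside the existential allows a choice for all `t`; the value `wstar` beyond the
  -- horizon is a dummy. The leader taken from `hinv` need not be the one chosen in the previous
  -- round, as the conclusions of a round mention only its state and `z'`.
  have hnext : ∀ t, ∃ z', t < T → _ := fun t => by
    by_cases ht : t < T
    · obtain ⟨z, hz⟩ := hinv t ht.le
      obtain ⟨z', hz'⟩ := hround t ht z hz
      exact ⟨z', fun _ => hz'⟩
    · exact ⟨wstar, fun h => absurd h ht⟩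
  choose z hz using hnext
  -- Index shift: `z t` is the leader after the subgradient of round `t`, hence `y (t + 1)`.
  set y : ℕ → E d := fun t => Nat.casesOn t wstar z with hy
  have hyinv : ∀ t ≤ T, Invariant K Φ M ε (S t) (y t) := by
    intro t ht
    cases t with
    | zero => exact hinit
    | succ t => exact (hz t ht).1
  have hSs : ∀ t, (S (t + 1)).s - (S t).s = η • g t := fun t => by
    rw [hSdef, state_succ_s, add_sub_cancel_left]
  have hwball : ∀ t ≤ T, _ := fun t ht =>
    (hyinv t ht).landmark.hessian_bounds hΦ hK hM ((hyinv t ht).ball hM)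
  have hcount : ∀ t ≤ T, ((run O η M m wstar g t).count Op.hessCall : ℝ) +
      41 * M * localNorm (S t).H ((S t).w - (S t).u) ≤
      1 + ∑ i ∈ Finset.range t, 41 * M * (7 * ε + 1.375 * (η * a i)) := by
    intro t
    induction t with
    | zero =>
      intro _
      rw [count_run_zero_hessCall, hSdef, state_zero]
      simp [localNorm_zero]
    | succ t ih =>
      intro ht
      have h1 := ih (by omega)
      have h2 := (hz t ht).2.2.2
      rw [count_run_succ, Finset.sum_range_succ]
      push_cast
      change _ ≤ _ + 41 * M * (7 * ε + 1.375 * (η * a t)) at h2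
      change _ + _ + 41 * M * localNorm (playRound O η M m (S t) (g t)).val.H
        ((playRound O η M m (S t) (g t)).val.w - (playRound O η M m (S t) (g t)).val.u) ≤ _
      linarith
  have hsum0 : 0 ≤ ∑ t ∈ Finset.range T, η * a t :=
    Finset.sum_nonneg fun t _ => mul_nonneg hη.le (ha0 t)
  have hhess : ((run O η M m wstar g T).count Op.hessCall : ℝ) ≤
      1 + 400 * (M * T * ε + M * ∑ t ∈ Finset.range T, η * a t) := by
    have h1 := hcount T le_rfl
    have h2 : 0 ≤ 41 * M * localNorm (S T).H ((S T).w - (S T).u) :=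
      mul_nonneg (by positivity) (localNorm_nonneg _ _)
    rw [← Finset.mul_sum, Finset.sum_add_distrib, ← Finset.mul_sum, Finset.sum_const,
      Finset.card_range, nsmul_eq_mul, ← Finset.mul_sum] at h1
    have h3 : 0 ≤ M * T * ε := by positivity
    have h4 : 0 ≤ M * ∑ t ∈ Finset.range T, η * a t := mul_nonneg hM.le hsum0
    linarith
  refine ⟨fun t ht => (hwball t ht).1, fun t ht k _ => ?_, fun w hw => ?_, hhess,
    fun Cgrad Chess hCg hCh => ?_⟩
  · have := (hz t ht).2.2.1 k
    rwa [← state_succ_s] at this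
  · have hlead := hΦ.sum_inner_le (y := y) (s := fun t => (S t).s) (T := T)
      (fun t ht => (hyinv t ht).minimizer_mem hΦ hK hM hεM) (fun t ht => (hyinv t ht).gradient_eq)
      rfl hw
    simp only [hSs, inner_smul_left, conj_trivial, ← Finset.mul_sum] at hlead
    rw [mul_comm, ← le_div_iff₀ hη] at hlead
    -- The loss is linearized at the played point and split at the next leader; the second part
    -- costs 1.1 · a · (4ε + 1.375ηa) by duality of the local norms.
    have hstep : ∀ t ∈ Finset.range T, l t (iterate O η M m wstar g t) - l t w ≤
        inner ℝ (g t) (y (t + 1) - w) + (400 * (η * a t ^ 2) + 400 * (ε * a t)) := by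
      intro t ht
      have ht := Finset.mem_range.mp ht
      obtain ⟨hK', _, hH'⟩ := hwball t ht.le
      have h1 := hsub t ht w (interior_subset hw)
      have h2 := abs_inner_le (hΦ.hessian_posDef hK hK') (g t) ((S t).w - y (t + 1))
      have h3 := localNorm_hessian_le hH' ((hyinv t ht.le).landmark.posDef hΦ hK).posSemidef
        ((S t).w - y (t + 1))
      have h4 : localNorm (S t).H ((S t).w - y (t + 1)) ≤ 4 * ε + 1.375 * (η * a t) :=
        (hz t ht).2.1
      change |inner ℝ (g t) ((S t).w - y (t + 1))| ≤ a t * _ at h2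
      change l t (S t).w + inner ℝ (g t) (w - (S t).w) ≤ _ at h1
      change l t (S t).w - _ ≤ _
      have h5 := mul_le_mul_of_nonneg_left
        (h3.trans (mul_le_mul_of_nonneg_left h4 (by norm_num))) (ha0 t)
      have h6 := (le_abs_self _).trans (h2.trans h5)
      have h7 : 0 ≤ η * a t ^ 2 := by positivity
      have h8 : 0 ≤ ε * a t := mul_nonneg hε.le (ha0 t)
      simp only [inner_sub_right] at h1 h6 ⊢
      linarith
    refine (Finset.sum_le_sum hstep).trans ?_
    rw [Finset.sum_add_distrib, Finset.sum_add_distrib]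
    simp only [← Finset.mul_sum]
    have h0 : 0 ≤ (Φ w - Φ wstar) / η := div_nonneg (sub_nonneg.mpr (hwmin hw)) hη.le
    change _ ≤ (Φ w - Φ wstar) / η at hlead
    linarith
  · rw [Timed.totalCost, count_run_arith, count_run_gradCall]
    have h1 := mul_le_mul_of_nonneg_left (round_arith_le hd hL hm₂) (Nat.cast_nonneg (α := ℝ) T)
    have h2 := mul_le_mul_of_nonneg_left hhess hCh
    have h3 : Cgrad * ((T * (m - 1) : ℕ) : ℝ) ≤ Cgrad * (T * (c₂ * L)) := by
      rw [Nat.cast_mul]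
      have : ((m - 1 : ℕ) : ℝ) ≤ m := by exact_mod_cast Nat.sub_le m 1
      gcongr
      linarith
    rw [Nat.cast_mul]
    change _ ≤ Chess + (4 * c₂ + 411) * ((Cgrad + (d : ℝ) ^ 2) * T * L +
      Chess * (M * T * ε + M * ∑ t ∈ Finset.range T, η * a t))
    have hX : 0 ≤ M * T * ε + M * ∑ t ∈ Finset.range T, η * a t := by positivity
    generalize M * T * ε + M * ∑ t ∈ Finset.range T, η * a t = X at *
    have h4 : 0 ≤ Cgrad * T * L := by positivity
    have h5 : 0 ≤ (d : ℝ) ^ 2 * T * L := by positivity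
    have h6 : 0 ≤ Chess * X := by positivity
    nlinarith
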